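/- Let $K$ be a non-archimedean local field with absolute value $|\cdot|_K$, and let $dx$ be the Haar measure on $K$ for which the unit ball $O_K$ has measure $1$. Let $Z\subset K$ be compact and open, and let $\mathcal U$ be a verticial covering of $Z$, that is, a finite covering of $Z$ by non-empty, mutually disjoint sets $U$ with $\bigcup_{U\in\mathcal U}U=Z$, each of which is an intersection of spheres $\{x\in K:|x-c|_K=r_U\}$ of equal radius $r_U>0$ (with at least one sphere; $r_U$ may depend on $U$). Let $A=(A_{UV})_{U,V\in\mathcal U}$ be a symmetric matrix with non-negative real entries and $A_{UU}=0$ for all $U\in\mathcal U$, let $\alpha\in\mathbb R$ and $\epsilon>0$. For $f\in C(Z)$, the Banach space of continuous real-valued functions on $Z$ with the supremum norm, put $$\mathcal D^\alpha_{A,\mathcal U}f(x)=\int_Z A^\alpha_{\mathcal U}(x,y)\,(f(y)-f(x))\,dy,\qquad A^\alpha_{\mathcal U}(x,y)=\sum_{U,V\in\mathcal U}A_{UV}\,|x-y|_K^\alpha\,1_U(x)\,1_V(y)$$ (terms with $A_{UV}=0$ are read as $0$). Theorem. There exists a transition function $p_t(x,\cdot)$ ($t\ge 0$, $x\in Z$)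 on the Borel $\sigma$-algebra of $Z$, i.e. each $p_t(x,\cdot)$ is a probability measure, $(t,x)\mapsto p_t(x,B)$ is measurable for every Borel set $B\subseteq Z$, $p_0(x,\cdot)=\delta_x$, and $p_{s+t}(x,B)=\int_Z p_t(y,B)\,p_s(x,dy)$ for all $s,t\ge0$, with the following two properties. 1. For every $h_0\in C(Z)$, the Cauchy problem $$\frac{\partial h}{\partial t}=\epsilon\,\mathcal D^\alpha_{A,\mathcal U}h\quad(t>0),\qquad h(0,\cdot)=h_0,$$ has a unique solution $h\in C([0,\infty),C(Z))\cap C^1((0,\infty),C(Z))$. This solution satisfies the equation also at $t=0$, with the one-sided derivative in $C(Z)$, and it is given by $$h(t,x)=\int_Z h_0(y)\,p_t(x,dy)\qquad(t\ge0,\ x\in Z).$$ 2. $p_t(x,\cdot)$ is the transition function of a Markov process in $Z$ whose paths are right continuous and have no discontinuities other than jumps. That is, there are a measurable space $\Omega$, measurable maps $X_t\colon\Omega\to Z$ ($t\ge0$) and probability measures $P_x$ ($x\in Z$) on $\Omega$, depending measurably on $x$, such that $P_x(X_0=x)=1$ and $$P_x\bigl(X_{s+t}\in B\mid \sigma(X_r:r\le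 s)\bigr)=p_t(X_s,B)\quad P_x\text{-almost surely}$$ for all $x\in Z$, $s,t\ge0$ and Borel sets $B\subseteq Z$, and such that for every $\omega\in\Omega$ the path $t\mapsto X_t(\omega)$ is right continuous with left limits. -/

import Mathlib

open Set Filter Topology MeasureTheory ProbabilityTheory
open scoped NNReal

universe u

/-- `U` is a verticial covering of `Z`: finitely many non-empty, mutually disjoint sets with union
`Z`, each of which is an intersection of spheres of equal (positive) radius; the radius may change
from one piece to another. Such a piece is automatically a holed disc, namely a disc from which
some maximal proper subdiscs have been removed (a full disc of radius `r` is the intersection of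
the spheres of the next larger radius around the points outside it that are closest to it). -/
structure IsVerticialCovering {K : Type u} [NormedField K] {ι : Type*}
    (Z : Set K) (U : ι → Set K) : Prop where
  finite : Finite ι
  nonempty : ∀ i, (U i).Nonempty
  disjoint : ∀ i j, i ≠ j → Disjoint (U i) (U j)
  iUnion_eq : ⋃ i, U i = Z
  spheres : ∀ i, ∃ r : ℝ, 0 < r ∧ ∃ C : Set K, C.Nonempty ∧ U i = ⋂ c ∈ C, Metric.sphere c r

/-- The kernel `A^α_𝒰(x, y) = ∑_{U, V} A_{UV} |x - y|^α Ω(x ∈ U) Ω(y ∈ V)`. -/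
noncomputable def zunigaKernel {K : Type u} [NormedField K] {ι : Type*} [Fintype ι]
    (U : ι → Set K) (A : Matrix ι ι ℝ) (α : ℝ) (x y : K) : ℝ :=
  ∑ i, ∑ j, A i j * ‖x - y‖ ^ α * (U i).indicator 1 x * (U j).indicator 1 y

/-- The operator `D^α_{A,𝒰} f (x) = ∫_Z A^α_𝒰(x, y) (f(y) - f(x)) dy` on functions on `Z`. -/
noncomputable def zunigaOperator {K : Type u} [NormedField K] [MeasurableSpace K]
    (μ : Measure K) (Z : Set K) {ι : Type*} [Fintype ι]
    (U : ι → Set K) (A : Matrix ι ι ℝ) (α : ℝ) (f : Z → ℝ) (x : Z) : ℝ :=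
  ∫ y : Z, zunigaKernel U A α (x : K) (y : K) * (f y - f x) ∂(μ.comap Subtype.val)

/-- At time `t`, the curve `h` in the Banach space `C(S)` (sup norm) has a derivative, one-sided
if `t = 0`, and this derivative is `L (h t)`. -/
def SatisfiesEvolutionEqAt {S : Type*} [TopologicalSpace S] [CompactSpace S]
    (L : (S → ℝ) → S → ℝ) (h : ℝ → C(S, ℝ)) (t : ℝ) : Prop :=
  ∃ g : C(S, ℝ), HasDerivWithinAt h g (Ici 0) t ∧ ∀ x, g x = L (h t) x

/-- `h` solves the Cauchy problem `∂h/∂t = L h`, `h(0) = h₀`: it is continuous on `[0, ∞)` and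
continuously differentiable on `(0, ∞)` with values in `C(S)` and satisfies the equation on
`(0, ∞)`. -/
structure IsCauchySolution {S : Type*} [TopologicalSpace S] [CompactSpace S]
    (L : (S → ℝ) → S → ℝ) (h₀ : C(S, ℝ)) (h : ℝ → C(S, ℝ)) : Prop where
  continuousOn : ContinuousOn h (Ici 0)
  contDiffOn : ContDiffOn ℝ 1 h (Ioi 0)
  eqn : ∀ t, 0 < t → SatisfiesEvolutionEqAt L h t
  init : h 0 = h₀

/-- `p` is a (time homogeneous, conservative) transition function on `S`. -/
structure IsTransitionFunction {S : Type*} [MeasurableSpace S]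
    (p : ℝ≥0 → Kernel S S) : Prop where
  isProbabilityMeasure : ∀ t x, IsProbabilityMeasure (p t x)
  measurable : ∀ B : Set S, MeasurableSet B → Measurable fun q : ℝ≥0 × S => p q.1 q.2 B
  zero : ∀ x, p 0 x = Measure.dirac x
  chapmanKolmogorov : ∀ (s t : ℝ≥0) (x : S) (B : Set S), MeasurableSet B →
    p (s + t) x B = ∫⁻ y, p t y B ∂(p s x)

/-- The process `X` on the measurable space `Ω`, under the probability measures `P x`, `x ∈ S`, is
a Markov process with transition function `p`: under `P x` it starts at `x`, and it has the Markov
property with respect to its natural filtration. -/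
structure IsMarkovProcess {S Ω : Type*} [MeasurableSpace S] [MeasurableSpace Ω]
    (p : ℝ≥0 → Kernel S S) (P : Kernel S Ω) (X : ℝ≥0 → Ω → S) : Prop where
  isProbabilityMeasure : ∀ x, IsProbabilityMeasure (P x)
  measurable : ∀ t, Measurable (X t)
  start : ∀ x, (P x).map (X 0) = Measure.dirac x
  markov : ∀ (x : S) (s t : ℝ≥0) (B : Set S), MeasurableSet B →
    (P x)[(X (s + t) ⁻¹' B).indicator (fun _ => (1 : ℝ)) |
        ⨆ r : Iic s, MeasurableSpace.comap (X r) inferInstance]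
      =ᵐ[P x] fun ω => (p t (X s ω)).real B

/-- The path `w` is right continuous and its only discontinuities are jumps, that is, all its left
limits exist. -/
def IsCadlagPath {S : Type*} [TopologicalSpace S] (w : ℝ≥0 → S) : Prop :=
  ∀ t, ContinuousWithinAt w (Ici t) t ∧ ∃ l, Tendsto w (𝓝[<] t) (𝓝 l)

/-! The pieces of the covering are clopen in `Z`, and `A` vanishes on the diagonal, so `|x - y|^α`
only enters for `x`, `y` in different pieces, away from its singularity. The kernel `k` is therefore
continuous, non-negative and bounded on the compact space `Z`, and `f ↦ ε ∫ k(x, y) (f y - f x) dy`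
is a bounded operator `L` on `C(Z)`. The Cauchy problem is a linear ODE in a Banach space, solved
uniquely by `exp(tL) h₀`.

The process is built by uniformization. With `N` a positive bound for `k` and `m` the measure on
`Z`, proposals arrive at rate `r = ε N m(Z)`. Each one draws a point `y` from normalized `m` and a
uniform number `u`, and the path jumps to `y` if `u ≤ k(x, y) / N`. Thinning gives `L f x = r (E f(F
x e) - f x)`, where `F x e` is the state after one proposal. Almost surely only finitely many
proposals occur in bounded time, so the paths are step functions.

Everything else is conditioning on the first proposal. Two quantities that satisfy the same renewal
equation on `[0, s]` agree, because the equation contracts by `P(τ ≤ s) < 1`, where `τ` is the first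
waiting time (`le_of_forall_le_add_mul`). This is used twice: for the Markov property
(`jointProb_eq_restartProb`, where memorylessness of the exponential law enters) and for `exp(tL) f
(x) = E_x f(X_t)` (`expSolution_eq_integral`, where variation of constants gives the renewal
equation). -/

namespace JumpChain

/-! ### Step paths driven by a sequence of waiting times and marks -/

variable {S E : Type*}

/-- The time of the `n`-th jump, when `ω` lists the waiting times and the marks of the jumps. -/
def arrival (ω : ℕ → ℝ × E) (n : ℕ) : ℝ := ∑ i ∈ Finset.range n, (ω i).1

/-- The state after `n` jumps, starting from `x`. -/
def state (F : S → E → S) (x : S) (ω : ℕ → ℝ × E) : ℕ → S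
  | 0 => x
  | n + 1 => F (state F x ω n) (ω n).2

/-- The waiting times are non-negative and their sum diverges. -/
def nonExplosive : Set (ℕ → ℝ × E) :=
  {ω | (∀ n, 0 ≤ (ω n).1) ∧ ∀ N : ℕ, ∃ n, (N : ℝ) < arrival ω n}

/-- Prepend a waiting time and a mark. -/
def cons (z : ℝ × E) (ω : ℕ → ℝ × E) : ℕ → ℝ × E
  | 0 => z
  | n + 1 => ω n

lemma arrival_mono {ω : ℕ → ℝ × E} (h : ω ∈ nonExplosive) : Monotone (arrival ω) := by
  refine monotone_nat_of_le_succ fun n => ?_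
  rw [arrival, arrival, Finset.sum_range_succ]
  linarith [h.1 n]

/-- Non-explosiveness is put inside the existential so that a minimal `n` exists for every `ω`; on
explosive sequences it is `0`. -/
lemma exists_lt_arrival (ω : ℕ → ℝ × E) (t : ℝ) :
    ∃ n, ω ∈ nonExplosive → t < arrival ω (n + 1) := by
  by_cases h : ω ∈ nonExplosive
  · obtain ⟨N, hN⟩ := exists_nat_gt t
    obtain ⟨n, hn⟩ := h.2 N
    exact ⟨n, fun _ => (hN.trans hn).trans_le (arrival_mono h n.le_succ)⟩
  · exact ⟨0, fun h' => absurd h' h⟩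

open Classical in
/-- The number of jumps up to time `t`, which is set to `0` on explosive sequences. -/
noncomputable def count (ω : ℕ → ℝ × E) (t : ℝ) : ℕ := Nat.find (exists_lt_arrival ω t)

/-- The piecewise constant path that starts at `x` and whose jumps are given by `ω`. -/
noncomputable def path (F : S → E → S) (x : S) (ω : ℕ → ℝ × E) (t : ℝ) : S :=
  state F x ω (count ω t)

lemma count_eq_zero_of_lt {ω : ℕ → ℝ × E} {t : ℝ} (h : t < (ω 0).1) : count ω t = 0 := by
  classical
  rw [count, Nat.find_eq_zero]
  intro _
  simpa [arrival] using h

lemma count_eq_of_mem_Ico {ω : ℕ → ℝ × E} (hω : ω ∈ nonExplosive) {t : ℝ} {n : ℕ}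
    (h₁ : arrival ω n ≤ t) (h₂ : t < arrival ω (n + 1)) : count ω t = n := by
  classical
  rw [count, Nat.find_eq_iff]
  refine ⟨fun _ => h₂, fun m hm h => ?_⟩
  exact absurd (h hω) (not_lt.2 ((arrival_mono hω (Nat.succ_le_of_lt hm)).trans h₁))

lemma count_spec {ω : ℕ → ℝ × E} (hω : ω ∈ nonExplosive) {t : ℝ} (ht : 0 ≤ t) :
    arrival ω (count ω t) ≤ t ∧ t < arrival ω (count ω t + 1) := by
  classical
  refine ⟨?_, Nat.find_spec (exists_lt_arrival ω t) hω⟩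
  rcases Nat.eq_zero_or_pos (count ω t) with h | h
  · rw [h]
    simpa [arrival] using ht
  · have := Nat.find_min (exists_lt_arrival ω t) (m := count ω t - 1)
      (Nat.sub_lt h one_pos)
    rw [Nat.sub_one_add_one h.ne'] at this
    push Not at this
    exact this.2

@[simp] lemma arrival_zero (ω : ℕ → ℝ × E) : arrival ω 0 = 0 := by simp [arrival]

lemma arrival_cons (z : ℝ × E) (ω : ℕ → ℝ × E) (n : ℕ) :
    arrival (cons z ω) (n + 1) = z.1 + arrival ω n := by
  rw [arrival, arrival, Finset.sum_range_succ', add_comm]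
  rfl

lemma state_cons (F : S → E → S) (x : S) (z : ℝ × E) (ω : ℕ → ℝ × E) (n : ℕ) :
    state F x (cons z ω) (n + 1) = state F (F x z.2) ω n := by
  induction n with
  | zero => rfl
  | succ n ih => rw [state, ih]; rfl

lemma cons_mem_nonExplosive {z : ℝ × E} (hz : 0 ≤ z.1) {ω : ℕ → ℝ × E} (hω : ω ∈ nonExplosive) :
    cons z ω ∈ nonExplosive := by
  refine ⟨fun n => ?_, fun N => ?_⟩
  · cases n
    exacts [hz, hω.1 _]
  · obtain ⟨n, hn⟩ := hω.2 N
    exact ⟨n + 1, by rw [arrival_cons]; linarith⟩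

lemma path_of_lt (F : S → E → S) (x : S) {ω : ℕ → ℝ × E} {t : ℝ} (h : t < (ω 0).1) :
    path F x ω t = x := by
  rw [path, count_eq_zero_of_lt h]; rfl

/-- The pathwise form of conditioning on the first jump, from which all renewal equations below are
derived. -/
lemma path_cons (F : S → E → S) (x : S) {z : ℝ × E} (hz : 0 ≤ z.1) {ω : ℕ → ℝ × E}
    (hω : ω ∈ nonExplosive) (t : ℝ) :
    path F x (cons z ω) t = if t < z.1 then x else path F (F x z.2) ω (t - z.1) := by
  split_ifs with h
  · exact path_of_lt F x h
  · obtain ⟨h₁, h₂⟩ := count_spec hω (sub_nonneg.2 (not_lt.1 h))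
    rw [path, path, ← state_cons]
    congr 1
    apply count_eq_of_mem_Ico (cons_mem_nonExplosive hz hω) <;> rw [arrival_cons] <;> linarith

/-- No exceptional null set is needed: explosive sequences give constant paths, and the others give
paths that are constant on each interval between consecutive arrivals. -/
lemma isCadlagPath_path [TopologicalSpace S] (F : S → E → S) (x : S) (ω : ℕ → ℝ × E) :
    IsCadlagPath fun t : ℝ≥0 => path F x ω t := by
  classical
  by_cases hω : ω ∈ nonExplosive
  swap
  · have : ∀ t, path F x ω t = x := fun t => by
      have : count ω t = 0 := by
        rw [count, Nat.find_eq_zero]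
        exact fun h => absurd h hω
      rw [path, this]; rfl
    simp only [this]
    exact fun t => ⟨continuousWithinAt_const, x, tendsto_const_nhds⟩
  intro t
  constructor
  · obtain ⟨h₁, h₂⟩ := count_spec hω t.2
    refine ContinuousWithinAt.congr_of_eventuallyEq (f := fun _ => path F x ω t)
      continuousWithinAt_const ?_ rfl
    have : ∀ᶠ s : ℝ≥0 in 𝓝[≥] t, (s : ℝ) < arrival ω (count ω t + 1) :=
      (NNReal.continuous_coe.continuousAt.eventually (Iio_mem_nhds h₂)).filter_mono
        nhdsWithin_le_nhds
    filter_upwards [this, self_mem_nhdsWithin] with s hs hts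
    rw [path, path, count_eq_of_mem_Ico hω (h₁.trans (NNReal.coe_le_coe.2 hts)) hs]
    rfl
  · rcases eq_or_ne t 0 with rfl | ht
    · have : (Iio (0 : ℝ≥0)) = ∅ := by ext; simp
      exact ⟨x, by rw [this, nhdsWithin_empty]; exact tendsto_bot⟩
    -- Unlike in `count`, the inequality is not strict: at a jump time the left limit is the state
    -- before the jump.
    have hex : ∃ n, (t : ℝ) ≤ arrival ω (n + 1) :=
      (exists_lt_arrival ω t).imp fun n hn => (hn hω).le
    set n := Nat.find hex with hn
    have h₂ : (t : ℝ) ≤ arrival ω (n + 1) := Nat.find_spec hex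
    have h₁ : arrival ω n < t := by
      rcases Nat.eq_zero_or_pos n with h | h
      · rw [h, arrival_zero]
        exact NNReal.coe_pos.2 (pos_iff_ne_zero.2 ht)
      · have := Nat.find_min hex (m := n - 1) (Nat.sub_lt h one_pos)
        rwa [Nat.sub_one_add_one h.ne', not_le] at this
    refine ⟨state F x ω n, tendsto_const_nhds.congr' ?_⟩
    have : ∀ᶠ s : ℝ≥0 in 𝓝[<] t, arrival ω n < s :=
      (NNReal.continuous_coe.continuousAt.eventually (Ioi_mem_nhds h₁)).filter_mono
        nhdsWithin_le_nhds
    filter_upwards [this, self_mem_nhdsWithin] with s hs hts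
    rw [path, count_eq_of_mem_Ico hω hs.le ((NNReal.coe_lt_coe.2 hts).trans_le h₂)]

/-! ### Measurability of the paths -/

variable [MeasurableSpace S] [MeasurableSpace E]

@[fun_prop]
lemma measurable_arrival (n : ℕ) : Measurable fun ω : ℕ → ℝ × E => arrival ω n := by
  unfold arrival
  fun_prop

lemma measurableSet_nonExplosive : MeasurableSet (nonExplosive : Set (ℕ → ℝ × E)) := by
  have : (nonExplosive : Set (ℕ → ℝ × E)) =
      (⋂ n, {ω | 0 ≤ (ω n).1}) ∩ ⋂ N : ℕ, ⋃ n, {ω | (N : ℝ) < arrival ω n} := by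
    ext ω
    simp [nonExplosive]
  rw [this]
  refine (MeasurableSet.iInter fun n => measurableSet_le (by fun_prop) (by fun_prop)).inter
    (MeasurableSet.iInter fun N => MeasurableSet.iUnion fun n => ?_)
  exact measurableSet_lt (by fun_prop) (by fun_prop)

lemma measurable_count : Measurable fun q : ℝ × (ℕ → ℝ × E) => count q.2 q.1 := by
  classical
  refine measurable_find (p := fun q : ℝ × (ℕ → ℝ × E) => fun n =>
    q.2 ∈ nonExplosive → q.1 < arrival q.2 (n + 1)) _ fun n => ?_
  have : {q : ℝ × (ℕ → ℝ × E) | q.2 ∈ nonExplosive → q.1 < arrival q.2 (n + 1)} =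
      (Prod.snd ⁻¹' nonExplosive)ᶜ ∪ {q | q.1 < arrival q.2 (n + 1)} := by
    ext q
    simp [imp_iff_not_or]
  rw [this]
  refine (measurable_snd measurableSet_nonExplosive).compl.union (measurableSet_lt (by fun_prop) ?_)
  exact (measurable_arrival _).comp measurable_snd

variable {F : S → E → S}

lemma measurable_state (hF : Measurable (Function.uncurry F)) (n : ℕ) :
    Measurable fun q : S × (ℕ → ℝ × E) => state F q.1 q.2 n := by
  induction n with
  | zero => exact measurable_fst
  | succ n ih =>
    exact hF.comp (ih.prodMk (by fun_prop : Measurable fun q : S × (ℕ → ℝ × E) => (q.2 n).2))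

lemma measurable_path (hF : Measurable (Function.uncurry F)) :
    Measurable fun q : ℝ × S × (ℕ → ℝ × E) => path F q.2.1 q.2.2 q.1 := by
  have h : Measurable fun q : ℕ × S × (ℕ → ℝ × E) => state F q.2.1 q.2.2 q.1 :=
    measurable_from_prod_countable_right fun n => measurable_state hF n
  exact h.comp ((measurable_count.comp (measurable_fst.prodMk
    (measurable_snd.comp measurable_snd))).prodMk measurable_snd)

lemma measurable_cons : Measurable fun q : (ℝ × E) × (ℕ → ℝ × E) => cons q.1 q.2 := by
  refine measurable_pi_lambda _ fun n => ?_
  cases n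
  · exact measurable_fst
  · exact (measurable_pi_apply _).comp measurable_snd

end JumpChain

/-! ### Exponential waiting times and the law of the noise -/

namespace JumpChain

variable {S E : Type*} [MeasurableSpace S] [MeasurableSpace E] {r : ℝ}

lemma expMeasure_Iic (hr : 0 < r) (t : ℝ) :
    expMeasure r (Iic t) = ENNReal.ofReal (if 0 ≤ t then 1 - Real.exp (-(r * t)) else 0) := by
  rw [← lintegral_exponentialPDF_eq_antiDeriv hr]
  exact withDensity_apply _ measurableSet_Iic

lemma expMeasure_Iic_lt_one (hr : 0 < r) (t : ℝ) : expMeasure r (Iic t) < 1 := by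
  rw [expMeasure_Iic hr, ENNReal.ofReal_lt_one]
  split_ifs
  · linarith [Real.exp_pos (-(r * t))]
  · exact one_pos

lemma ae_expMeasure_pos (hr : 0 < r) : ∀ᵐ t ∂expMeasure r, 0 < t := by
  have : expMeasure r (Iic 0) = 0 := by simp [expMeasure_Iic hr]
  filter_upwards [measure_eq_zero_iff_ae_notMem.1 this] with t ht using not_le.1 ht

lemma lintegral_expMeasure (g : ℝ → ENNReal) (hg : Measurable g) :
    ∫⁻ t, g t ∂expMeasure r = ∫⁻ t, exponentialPDF r t * g t :=
  lintegral_withDensity_eq_lintegral_mul _ (measurable_exponentialPDFReal r).ennreal_ofReal hg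

/-- The exponential distribution has no memory. -/
lemma setLIntegral_expMeasure_sub (hr : 0 < r) {s : ℝ} (hs : 0 ≤ s) (g : ℝ → ENNReal)
    (hg : Measurable g) :
    ∫⁻ t in Ioi s, g (t - s) ∂expMeasure r = expMeasure r (Ioi s) * ∫⁻ t, g t ∂expMeasure r := by
  have := isProbabilityMeasure_expMeasure hr
  have key : ∀ g : ℝ → ENNReal, Measurable g → ∫⁻ t in Ioi s, g (t - s) ∂expMeasure r =
      ENNReal.ofReal (Real.exp (-(r * s))) * ∫⁻ t, g t ∂expMeasure r := by
    intro g hg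
    have hg' : Measurable fun t => g (t - s) := hg.comp (measurable_id.sub_const s)
    rw [← lintegral_indicator measurableSet_Ioi,
      lintegral_expMeasure _ (hg'.indicator measurableSet_Ioi), lintegral_expMeasure _ hg,
      ← lintegral_const_mul _ (by unfold exponentialPDF; fun_prop),
      ← lintegral_add_right_eq_self _ s]
    refine lintegral_congr_ae ?_
    -- At `0` the density is positive but the shifted indicator of `Ioi s` vanishes, so this point
    -- is discarded.
    filter_upwards [(measure_eq_zero_iff_ae_notMem.1 (measure_singleton (0 : ℝ)) :
      ∀ᵐ t : ℝ, t ∉ ({0} : Set ℝ))] with t ht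
    rcases lt_or_gt_of_ne (show t ≠ 0 from ht) with h | h
    · rw [indicator_of_notMem (by simpa using h.le), exponentialPDF_of_neg h]
      simp
    · rw [indicator_of_mem (by simpa using h), exponentialPDF_of_nonneg h.le,
        exponentialPDF_of_nonneg (by linarith), add_sub_cancel_right, ← mul_assoc,
        ← ENNReal.ofReal_mul (Real.exp_pos _).le, mul_left_comm, ← Real.exp_add]
      ring_nf
  rw [key g hg]
  congr 1
  -- The case `g = 1` identifies the factor `exp(-rs)` as the tail probability.
  simpa using (key 1 measurable_one).symm

variable (r) in
/-- The law of a waiting time and a mark. -/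
noncomputable def stepLaw (ν : Measure E) : Measure (ℝ × E) := (expMeasure r).prod ν

variable (r) in
/-- The law of the sequence of independent waiting times and marks. -/
noncomputable def noiseLaw (ν : Measure E) : Measure (ℕ → ℝ × E) :=
  Measure.infinitePi fun _ => stepLaw r ν

lemma ae_stepLaw_pos {ν : Measure E} (hr : 0 < r) : ∀ᵐ z ∂stepLaw r ν, 0 < z.1 :=
  Measure.quasiMeasurePreserving_fst.ae (ae_expMeasure_pos hr)

lemma lintegral_eq_setLIntegral_add {μ : Measure (ℝ × E)} (s : ℝ) (g : ℝ × E → ENNReal) :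
    ∫⁻ z, g z ∂μ = ∫⁻ z in Prod.fst ⁻¹' Iic s, g z ∂μ + ∫⁻ z in Prod.fst ⁻¹' Ioi s, g z ∂μ := by
  rw [← lintegral_add_compl g (measurable_fst measurableSet_Iic), ← preimage_compl, compl_Iic]

variable {ν : Measure E} [IsProbabilityMeasure ν]

lemma isProbabilityMeasure_stepLaw (hr : 0 < r) : IsProbabilityMeasure (stepLaw r ν) := by
  have := isProbabilityMeasure_expMeasure hr
  unfold stepLaw
  infer_instance

lemma isProbabilityMeasure_noiseLaw (hr : 0 < r) : IsProbabilityMeasure (noiseLaw r ν) := by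
  have := isProbabilityMeasure_stepLaw (ν := ν) hr
  unfold noiseLaw
  infer_instance

lemma stepLaw_fst_preimage (s : Set ℝ) :
    stepLaw r ν (Prod.fst ⁻¹' s) = expMeasure r s := by
  rw [← prod_univ, stepLaw, Measure.prod_prod]
  simp

lemma setLIntegral_stepLaw_sub (hr : 0 < r) {s : ℝ} (hs : 0 ≤ s) (g : ℝ × E → ENNReal)
    (hg : Measurable g) :
    ∫⁻ z in Prod.fst ⁻¹' Ioi s, g (z.1 - s, z.2) ∂stepLaw r ν =
      stepLaw r ν (Prod.fst ⁻¹' Ioi s) * ∫⁻ z, g z ∂stepLaw r ν := by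
  have := isProbabilityMeasure_expMeasure hr
  rw [stepLaw_fst_preimage, ← prod_univ, stepLaw, ← Measure.prod_restrict, Measure.restrict_univ,
    lintegral_prod_symm _ (by fun_prop), lintegral_prod_symm _ hg.aemeasurable,
    ← lintegral_const_mul _ hg.lintegral_prod_left']
  exact lintegral_congr fun e =>
    setLIntegral_expMeasure_sub hr hs (fun t => g (t, e)) (by fun_prop)

/-- An i.i.d. sequence with an independent copy of its terms prepended has the same law; a product
measure is determined by its values on finite-dimensional boxes. -/
lemma map_cons_noiseLaw (hr : 0 < r) :
    ((stepLaw r ν).prod (noiseLaw r ν)).map (fun q => cons q.1 q.2) = noiseLaw r ν := by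
  have := isProbabilityMeasure_stepLaw (ν := ν) hr
  have := isProbabilityMeasure_noiseLaw (ν := ν) hr
  refine Measure.eq_infinitePi _ fun s t ht => ?_
  -- Initial segments of indices suffice, since a box over any finite set becomes one after padding
  -- with `univ`. For them the prepended term splits off as the factor of index `0`.
  have h0 : ∀ (t : ℕ → Set (ℝ × E)), (∀ i, MeasurableSet (t i)) → ∀ N,
      ((stepLaw r ν).prod (noiseLaw r ν)).map (fun q => cons q.1 q.2)
      (Set.pi (Finset.range N) t) = ∏ i ∈ Finset.range N, stepLaw r ν (t i) := by
    intro t ht N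
    rw [Measure.map_apply measurable_cons (.pi (Finset.countable_toSet _) fun i _ => ht i)]
    cases N with
    | zero => simp
    | succ N =>
      have : (fun q : (ℝ × E) × (ℕ → ℝ × E) => cons q.1 q.2) ⁻¹'
          Set.pi (Finset.range (N + 1)) t =
          t 0 ×ˢ Set.pi (Finset.range N) (fun i => t (i + 1)) := by
        ext q
        simp only [mem_preimage, Set.mem_pi, Finset.coe_range, mem_Iio, mem_prod]
        constructor
        · exact fun h => ⟨h 0 N.succ_pos, fun i hi => h (i + 1) (Nat.succ_lt_succ hi)⟩
        · rintro ⟨h, h'⟩ (_ | i) hi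
          exacts [h, h' i (Nat.lt_of_succ_lt_succ hi)]
      rw [this, Measure.prod_prod, Finset.prod_range_succ', mul_comm, noiseLaw,
        Measure.infinitePi_pi _ fun i _ => ht _]
  obtain ⟨N, hN⟩ := s.exists_nat_subset_range
  classical
  have h1 := h0 (fun i => if i ∈ s then t i else univ)
    (fun i => by split_ifs; exacts [ht i, .univ]) N
  have h2 : Set.pi (Finset.range N) (fun i => if i ∈ s then t i else univ) = Set.pi s t := by
    ext ω
    simp only [Set.mem_pi, SetLike.mem_coe]
    refine ⟨fun h i hi => by simpa [hi] using h i (hN hi), fun h i _ => ?_⟩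
    split_ifs with hi
    exacts [h i hi, mem_univ _]
  rw [h2] at h1
  rw [h1, ← Finset.prod_subset hN fun i _ hi => by simp [hi]]
  exact Finset.prod_congr rfl fun i hi => by simp [hi]

lemma lintegral_noiseLaw (hr : 0 < r) (g : (ℕ → ℝ × E) → ENNReal) (hg : Measurable g) :
    ∫⁻ ω, g ω ∂noiseLaw r ν = ∫⁻ z, ∫⁻ ω, g (cons z ω) ∂noiseLaw r ν ∂stepLaw r ν := by
  have := isProbabilityMeasure_noiseLaw (ν := ν) hr
  conv_lhs => rw [← map_cons_noiseLaw hr]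
  rw [lintegral_map hg measurable_cons]
  exact lintegral_prod _ (hg.comp measurable_cons).aemeasurable

lemma integral_noiseLaw (hr : 0 < r) (g : (ℕ → ℝ × E) → ℝ) (hg : Integrable g (noiseLaw r ν)) :
    ∫ ω, g ω ∂noiseLaw r ν = ∫ z, ∫ ω, g (cons z ω) ∂noiseLaw r ν ∂stepLaw r ν := by
  have := isProbabilityMeasure_noiseLaw (ν := ν) hr
  have := isProbabilityMeasure_stepLaw (ν := ν) hr
  have h : MeasurePreserving (fun q : (ℝ × E) × (ℕ → ℝ × E) => cons q.1 q.2)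
    ((stepLaw r ν).prod (noiseLaw r ν)) (noiseLaw r ν) := ⟨measurable_cons, map_cons_noiseLaw hr⟩
  conv_lhs => rw [← map_cons_noiseLaw hr]
  rw [integral_map measurable_cons.aemeasurable (by rw [map_cons_noiseLaw hr]; exact hg.1)]
  exact integral_prod _ (h.integrable_comp_of_integrable hg)

lemma ae_waiting_pos (hr : 0 < r) (n : ℕ) : ∀ᵐ ω ∂noiseLaw r ν, 0 < (ω n).1 :=
  have := isProbabilityMeasure_stepLaw (ν := ν) hr
  ((measurePreserving_eval_infinitePi (fun _ : ℕ => stepLaw r ν) n).quasiMeasurePreserving.ae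
    (ae_stepLaw_pos hr) :)

/-- Almost surely infinitely many waiting times exceed `1`: the chance that `m` given ones are all
at most `1` is `P(τ ≤ 1) ^ m`, which tends to `0`. -/
lemma ae_nonExplosive (hr : 0 < r) : ∀ᵐ ω ∂noiseLaw r ν, ω ∈ nonExplosive := by
  have := isProbabilityMeasure_stepLaw (ν := ν) hr
  have hlarge : ∀ N, ∀ᵐ ω ∂noiseLaw r ν, ∃ n, N ≤ n ∧ 1 < (ω n).1 := by
    intro N
    rw [ae_iff]
    refine le_antisymm (ge_of_tendsto' (ENNReal.tendsto_pow_atTop_nhds_zero_of_lt_one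
      (expMeasure_Iic_lt_one hr 1)) fun m => ?_) zero_le
    calc noiseLaw r ν {ω | ¬∃ n, N ≤ n ∧ 1 < (ω n).1}
        ≤ noiseLaw r ν (Set.pi (Finset.Ico N (N + m)) fun _ => Prod.fst ⁻¹' Iic 1) := by
          refine measure_mono fun ω hω n hn => ?_
          simp only [mem_ofPred_eq, not_exists, not_and, not_lt] at hω
          exact hω n (Finset.mem_Ico.1 hn).1
      _ = expMeasure r (Iic 1) ^ m := by
          rw [noiseLaw, Measure.infinitePi_pi _ fun _ _ => measurable_fst measurableSet_Iic]
          simp [stepLaw_fst_preimage]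
  filter_upwards [ae_all_iff.2 (ae_waiting_pos hr), ae_all_iff.2 hlarge] with ω h1 h2
  refine ⟨fun n => (h1 n).le, fun N => ?_⟩
  have hmono : Monotone (arrival ω) := monotone_nat_of_le_succ fun n => by
    rw [arrival, arrival, Finset.sum_range_succ]; linarith [h1 n]
  induction N with
  | zero => exact ⟨1, by simpa [arrival] using h1 0⟩
  | succ N ih =>
    obtain ⟨n, hn⟩ := ih
    obtain ⟨k, hk, hk'⟩ := h2 n
    refine ⟨k + 1, ?_⟩
    have := hmono hk
    rw [arrival, Finset.sum_range_succ, ← arrival]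
    push_cast
    linarith

end JumpChain

/-! ### Renewal equations and the Markov property -/

namespace JumpChain

/-- Contraction principle: iterating improves the error from `C` to `q ^ n * C`, which tends to `0`.
The additive form avoids subtraction in `ENNReal`. -/
lemma le_of_forall_le_add_mul {I : Type*} {u v : I → ENNReal} {q C : ENNReal} (hC : C ≠ ⊤)
    (hq : q < 1) (h₀ : ∀ i, u i ≤ v i + C)
    (h : ∀ c, (∀ i, u i ≤ v i + c) → ∀ i, u i ≤ v i + q * c) (i : I) : u i ≤ v i := by
  have h' : ∀ n : ℕ, ∀ i, u i ≤ v i + q ^ n * C := by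
    intro n
    induction n with
    | zero => simpa using h₀
    | succ n ih =>
      intro i
      rw [pow_succ', mul_assoc]
      exact h _ ih i
  refine ge_of_tendsto' (x := atTop) ?_ fun n => h' n i
  have := ENNReal.Tendsto.mul_const (ENNReal.tendsto_pow_atTop_nhds_zero_of_lt_one hq)
    (b := C) (Or.inr hC)
  simpa using tendsto_const_nhds.add this

/-- The path `w`, delayed by `τ` and preceded by the constant `x`. -/
noncomputable def delay {S : Type*} (x : S) (τ : ℝ) (w : ℝ → S) (t : ℝ) : S :=
  if t < τ then x else w (t - τ)

section cons

variable {S E : Type*} {F : S → E → S} {z : ℝ × E} {ω : ℕ → ℝ × E} {x : S} {s : ℝ}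

lemma path_cons_min_of_le (hz : 0 ≤ z.1) (hω : ω ∈ nonExplosive) (hs : z.1 ≤ s) :
    (fun t => path F x (cons z ω) (min t s)) =
      delay x z.1 fun t => path F (F x z.2) ω (min t (s - z.1)) := by
  ext t
  rw [path_cons F x hz hω, delay, min_sub_sub_right]
  congr 1
  simp [hs]

lemma path_cons_min_of_lt (hs : s < z.1) :
    (fun t => path F x (cons z ω) (min t s)) = fun _ => x := by
  ext t
  exact path_of_lt F x ((min_le_right _ _).trans_lt hs)

lemma path_cons_add_of_le (hz : 0 ≤ z.1) (hω : ω ∈ nonExplosive) (hs : z.1 ≤ s) (t : ℝ≥0) :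
    path F x (cons z ω) (s + t) = path F (F x z.2) ω (s - z.1 + t) := by
  rw [path_cons F x hz hω, if_neg, add_sub_right_comm]
  exact not_lt.2 (hs.trans (le_add_of_nonneg_right t.2))

/-- If no jump has occurred by time `s`, the future is a path from `x` whose first waiting time is
the residual one. -/
lemma path_cons_add_of_lt (hω : ω ∈ nonExplosive) (hs₀ : 0 ≤ s) (hs : s < z.1) (t : ℝ) :
    path F x (cons z ω) (s + t) = path F x (cons (z.1 - s, z.2) ω) t := by
  rw [path_cons F x (hs₀.trans hs.le) hω, path_cons F x (sub_nonneg.2 hs.le) hω]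
  simp only [lt_sub_iff_add_lt']
  congr 2
  ring

end cons

/-- The probability, starting from `y`, that the path lies in `H`. -/
noncomputable def pathProb {S E : Type*} [MeasurableSpace E] (r : ℝ) (ν : Measure E)
    (F : S → E → S) (H : Set (ℝ≥0 → S)) (y : S) : ENNReal :=
  noiseLaw r ν {ω | (fun t : ℝ≥0 => path F y ω t) ∈ H}

lemma pathProb_le_one {S E : Type*} [MeasurableSpace E] {r : ℝ}
    {ν : Measure E} [IsProbabilityMeasure ν] {F : S → E → S} (hr : 0 < r) (H : Set (ℝ≥0 → S)) (y : S) :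
    pathProb r ν F H y ≤ 1 := by
  have := isProbabilityMeasure_noiseLaw (ν := ν) hr
  exact prob_le_one

variable {S E : Type*} [MeasurableSpace S] [MeasurableSpace E] {r : ℝ}
  {ν : Measure E} [IsProbabilityMeasure ν] {F : S → E → S}

lemma measurable_path_left (hF : Measurable (Function.uncurry F)) (t : ℝ) :
    Measurable fun q : S × (ℕ → ℝ × E) => path F q.1 q.2 t :=
  (measurable_path hF).comp (measurable_const.prodMk measurable_id)

lemma measurable_path_apply (hF : Measurable (Function.uncurry F)) (x : S) (t : ℝ) :
    Measurable fun ω : ℕ → ℝ × E => path F x ω t :=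
  (measurable_path_left hF t).comp (measurable_const.prodMk measurable_id)

lemma measurable_pathProb (hr : 0 < r) (hF : Measurable (Function.uncurry F))
    {H : Set (ℝ≥0 → S)} (hH : MeasurableSet H) : Measurable (pathProb r ν F H) := by
  have := isProbabilityMeasure_noiseLaw (ν := ν) hr
  have h : MeasurableSet {q : S × (ℕ → ℝ × E) | (fun t : ℝ≥0 => path F q.1 q.2 t) ∈ H} :=
    (measurable_pi_lambda _ fun t : ℝ≥0 => measurable_path_left hF t) hH
  exact measurable_measure_prodMk_left h

lemma measurable_delay (x : S) (τ : ℝ) : Measurable (delay x τ) := by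
  refine measurable_pi_lambda _ fun t => ?_
  unfold delay
  split_ifs <;> fun_prop

section

variable (r ν F)

/-- The event that the path stopped at `s` lies in `G`. -/
def pastEvent (G : Set (ℝ → S)) (x : S) (s : ℝ) : Set (ℕ → ℝ × E) :=
  {ω | (fun t => path F x ω (min t s)) ∈ G}

/-- The event that the path from time `s` on lies in `H`. -/
def futureEvent (H : Set (ℝ≥0 → S)) (x : S) (s : ℝ) : Set (ℕ → ℝ × E) :=
  {ω | (fun t : ℝ≥0 => path F x ω (s + t)) ∈ H}

end

lemma measurableSet_pastEvent (hF : Measurable (Function.uncurry F)) {G : Set (ℝ → S)}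
    (hG : MeasurableSet G) (x : S) (s : ℝ) :
    MeasurableSet (pastEvent F G x s : Set (ℕ → ℝ × E)) :=
  (measurable_pi_lambda _ fun t => measurable_path_apply hF x (min t s)) hG

lemma measurableSet_futureEvent (hF : Measurable (Function.uncurry F)) {H : Set (ℝ≥0 → S)}
    (hH : MeasurableSet H) (x : S) (s : ℝ) :
    MeasurableSet (futureEvent F H x s : Set (ℕ → ℝ × E)) :=
  (measurable_pi_lambda _ fun t : ℝ≥0 => measurable_path_apply hF x (s + t)) hH

/-- The probability of a past event and a future event together. -/
noncomputable def jointProb (r : ℝ) (ν : Measure E) (F : S → E → S) (H : Set (ℝ≥0 → S))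
    (G : Set (ℝ → S)) (x : S) (s : ℝ) : ENNReal :=
  noiseLaw r ν (pastEvent F G x s ∩ futureEvent F H x s)

/-- The same probability, when the future is restarted at time `s`. -/
noncomputable def restartProb (r : ℝ) (ν : Measure E) (F : S → E → S) (H : Set (ℝ≥0 → S))
    (G : Set (ℝ → S)) (x : S) (s : ℝ) : ENNReal :=
  ∫⁻ ω in pastEvent F G x s, pathProb r ν F H (path F x ω s) ∂noiseLaw r ν

/-- A first jump at `z.1 ≤ s` leaves the same problem from `F x z.2` with horizon `s - z.1`, the
past condition being pulled back along `delay`. Otherwise the past is the constant `x`, and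
memorylessness applies. -/
lemma jointProb_renewal (hr : 0 < r) (hF : Measurable (Function.uncurry F))
    {H : Set (ℝ≥0 → S)} (hH : MeasurableSet H) {G : Set (ℝ → S)} (hG : MeasurableSet G) (x : S)
    {s : ℝ} (hs : 0 ≤ s) :
    jointProb r ν F H G x s =
      ∫⁻ z in Prod.fst ⁻¹' Iic s, jointProb r ν F H (delay x z.1 ⁻¹' G) (F x z.2) (s - z.1)
        ∂stepLaw r ν +
      G.indicator 1 (fun _ => x) * stepLaw r ν (Prod.fst ⁻¹' Ioi s) * pathProb r ν F H x := by
  classical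
  have hm := (measurableSet_pastEvent (E := E) hF hG x s).inter
    (measurableSet_futureEvent hF hH x s)
  have hpath : MeasurableSet {ω : ℕ → ℝ × E | (fun t : ℝ≥0 => path F x ω t) ∈ H} :=
    (measurable_pi_lambda _ fun t : ℝ≥0 => measurable_path_apply hF x t) hH
  rw [jointProb, ← lintegral_indicator_one hm,
    lintegral_noiseLaw hr _ (measurable_one.indicator hm), lintegral_eq_setLIntegral_add s]
  congr 1
  · refine setLIntegral_congr_fun_ae (measurable_fst measurableSet_Iic) ?_
    filter_upwards [ae_stepLaw_pos hr] with z hz hzs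
    rw [jointProb, ← lintegral_indicator_one ((measurableSet_pastEvent hF
      (measurable_delay _ _ hG) _ _).inter (measurableSet_futureEvent hF hH _ _))]
    refine lintegral_congr_ae ?_
    filter_upwards [ae_nonExplosive hr] with ω hω
    simp only [indicator_apply, mem_inter_iff, pastEvent, futureEvent, mem_ofPred_eq,
      path_cons_min_of_le hz.le hω hzs, path_cons_add_of_le hz.le hω hzs]
    rfl
  · have hcons : Measurable fun z : ℝ × E =>
        ∫⁻ ω, {ω | (fun t : ℝ≥0 => path F x ω t) ∈ H}.indicator 1 (cons z ω) ∂noiseLaw r ν := by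
      have := isProbabilityMeasure_noiseLaw (ν := ν) hr
      exact Measurable.lintegral_prod_right
        (((measurable_one (α := ENNReal)).indicator hpath).comp measurable_cons)
    -- Beyond `s`, the residual waiting time and the mark again have law `stepLaw`, independent of
    -- the later noise, so the future is distributed as a fresh path from `x`.
    rw [mul_assoc, pathProb, ← lintegral_indicator_one hpath,
      lintegral_noiseLaw hr _ (measurable_one.indicator hpath),
      ← setLIntegral_stepLaw_sub hr hs _ hcons, ← lintegral_const_mul' _ _ (by
        rw [indicator_apply]; split_ifs <;> simp)]
    refine setLIntegral_congr_fun (measurable_fst measurableSet_Ioi) fun z hz => ?_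
    rw [← lintegral_const_mul' _ _ (by rw [indicator_apply]; split_ifs <;> simp)]
    refine lintegral_congr_ae ?_
    filter_upwards [ae_nonExplosive hr] with ω hω
    simp only [indicator_apply, mem_inter_iff, pastEvent, futureEvent, mem_ofPred_eq,
      path_cons_min_of_lt hz, path_cons_add_of_lt hω hs hz]
    by_cases h : (fun _ => x) ∈ G <;> simp [h]

/-- The same equation as for `jointProb`, but without memorylessness: if no jump occurs up to `s`,
the restart happens at `x` by definition. -/
lemma restartProb_renewal (hr : 0 < r) (hF : Measurable (Function.uncurry F))
    {H : Set (ℝ≥0 → S)} (hH : MeasurableSet H) {G : Set (ℝ → S)} (hG : MeasurableSet G) (x : S)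
    {s : ℝ} :
    restartProb r ν F H G x s =
      ∫⁻ z in Prod.fst ⁻¹' Iic s, restartProb r ν F H (delay x z.1 ⁻¹' G) (F x z.2) (s - z.1)
        ∂stepLaw r ν +
      G.indicator 1 (fun _ => x) * stepLaw r ν (Prod.fst ⁻¹' Ioi s) * pathProb r ν F H x := by
  classical
  have := isProbabilityMeasure_noiseLaw (ν := ν) hr
  have hm := measurableSet_pastEvent (E := E) hF hG x s
  have hmeas : ∀ x s, Measurable fun ω : ℕ → ℝ × E => pathProb r ν F H (path F x ω s) := fun x s =>
    (measurable_pathProb hr hF hH).comp (measurable_path_apply hF x s)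
  rw [restartProb, ← lintegral_indicator hm,
    lintegral_noiseLaw hr _ ((hmeas x s).indicator hm), lintegral_eq_setLIntegral_add s]
  congr 1
  · refine setLIntegral_congr_fun_ae (measurable_fst measurableSet_Iic) ?_
    filter_upwards [ae_stepLaw_pos hr] with z hz hzs
    rw [restartProb, ← lintegral_indicator (measurableSet_pastEvent hF
      (measurable_delay _ _ hG) _ _)]
    refine lintegral_congr_ae ?_
    filter_upwards [ae_nonExplosive hr] with ω hω
    have h := path_cons_add_of_le (F := F) (x := x) hz.le hω hzs 0
    simp only [NNReal.coe_zero, add_zero] at h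
    simp only [indicator_apply, pastEvent, mem_ofPred_eq, path_cons_min_of_le hz.le hω hzs, h]
    rfl
  · rw [mul_right_comm, ← setLIntegral_const]
    refine setLIntegral_congr_fun (measurable_fst measurableSet_Ioi) fun z hz => ?_
    have : ∀ ω, path F x (cons z ω) s = x := fun ω => path_of_lt F x hz
    simp only [indicator_apply, pastEvent, mem_ofPred_eq, path_cons_min_of_lt hz, this]
    split_ifs <;> simp

variable (r ν F) in
lemma le_of_renewal (hr : 0 < r) {u v : Set (ℝ → S) → S → ℝ → ENNReal} (hu : ∀ G x s, u G x s ≤ 1)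
    (R : Set (ℝ → S) → S → ℝ → ENNReal)
    (hu' : ∀ G x s, MeasurableSet G → 0 ≤ s → u G x s = ∫⁻ z in Prod.fst ⁻¹' Iic s,
      u (delay x z.1 ⁻¹' G) (F x z.2) (s - z.1) ∂stepLaw r ν + R G x s)
    (hv' : ∀ G x s, MeasurableSet G → 0 ≤ s → v G x s = ∫⁻ z in Prod.fst ⁻¹' Iic s,
      v (delay x z.1 ⁻¹' G) (F x z.2) (s - z.1) ∂stepLaw r ν + R G x s)
    {G : Set (ℝ → S)} (hG : MeasurableSet G) (x : S) {s : ℝ} (hs : 0 ≤ s) :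
    u G x s ≤ v G x s := by
  -- The index includes `G` and the starting point, since the renewal step changes both. Bounding
  -- all times by the original `s` gives one contraction factor `P(τ ≤ s)`.
  refine le_of_forall_le_add_mul
    (I := {i : Set (ℝ → S) × S × ℝ // MeasurableSet i.1 ∧ 0 ≤ i.2.2 ∧ i.2.2 ≤ s})
    (u := fun i => u i.1.1 i.1.2.1 i.1.2.2) (v := fun i => v i.1.1 i.1.2.1 i.1.2.2)
    ENNReal.one_ne_top (expMeasure_Iic_lt_one hr s) (fun i => (hu _ _ _).trans le_add_self)
    ?_ ⟨(G, x, s), hG, hs, le_rfl⟩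
  rintro c hc ⟨⟨G, x, t⟩, hG, ht, hts⟩
  simp only
  rw [hu' G x t hG ht, hv' G x t hG ht, add_right_comm]
  gcongr
  calc ∫⁻ z in Prod.fst ⁻¹' Iic t, u (delay x z.1 ⁻¹' G) (F x z.2) (t - z.1) ∂stepLaw r ν
      ≤ ∫⁻ z in Prod.fst ⁻¹' Iic t, (v (delay x z.1 ⁻¹' G) (F x z.2) (t - z.1) + c)
          ∂stepLaw r ν := by
        refine lintegral_mono_ae ?_
        filter_upwards [ae_restrict_mem (measurable_fst measurableSet_Iic),
          ae_restrict_of_ae (ae_stepLaw_pos hr)] with z hz hz'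
        have hz : z.1 ≤ t := hz
        exact hc ⟨(delay x z.1 ⁻¹' G, F x z.2, t - z.1), measurable_delay _ _ hG,
          sub_nonneg.2 hz, by simp only; linarith⟩
    _ ≤ _ := by
        rw [lintegral_add_right _ measurable_const, setLIntegral_const, stepLaw_fst_preimage,
          mul_comm c]
        gcongr

/-- The Markov property. -/
lemma jointProb_eq_restartProb (hr : 0 < r) (hF : Measurable (Function.uncurry F))
    {H : Set (ℝ≥0 → S)} (hH : MeasurableSet H) {G : Set (ℝ → S)} (hG : MeasurableSet G) (x : S)
    {s : ℝ} (hs : 0 ≤ s) :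
    jointProb r ν F H G x s = restartProb r ν F H G x s := by
  have := isProbabilityMeasure_noiseLaw (ν := ν) hr
  have h1 := fun G x s (hG : MeasurableSet G) (hs : 0 ≤ s) =>
    jointProb_renewal (ν := ν) hr hF hH hG x hs
  have h2 := fun G x s (hG : MeasurableSet G) (_ : 0 ≤ s) =>
    restartProb_renewal (ν := ν) hr hF hH hG x (s := s)
  refine le_antisymm (le_of_renewal r ν F hr (fun _ _ _ => prob_le_one) _ h1 h2 hG x hs)
    (le_of_renewal r ν F hr (fun G x s => ?_) _ h2 h1 hG x hs)
  calc restartProb r ν F H G x s ≤ ∫⁻ _, 1 ∂noiseLaw r ν :=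
        (setLIntegral_le_lintegral _ _).trans (lintegral_mono fun _ => pathProb_le_one hr H _)
    _ = 1 := by simp

end JumpChain

/-! ### The semigroup of a bounded generator and its probabilistic form -/

namespace JumpChain

section semigroup

variable {X : Type*} [NormedAddCommGroup X] [NormedSpace ℝ X]

/-- The solution of the linear equation with bounded generator `L` and initial value `f`. -/
noncomputable def expSolution (L : X →L[ℝ] X) (f : X) (t : ℝ) : X := NormedSpace.exp (t • L) f

lemma expSolution_zero (L : X →L[ℝ] X) (f : X) : expSolution L f 0 = f := by
  simp [expSolution]

variable [CompleteSpace X]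

lemma hasDerivAt_expSolution (L : X →L[ℝ] X) (f : X) (t : ℝ) :
    HasDerivAt (expSolution L f) (L (expSolution L f t)) t :=
  (hasDerivAt_exp_smul_const' L t).clm_apply (hasDerivAt_const t f) |>.congr_deriv (by
    simp [expSolution])

lemma continuous_expSolution (L : X →L[ℝ] X) (f : X) : Continuous (expSolution L f) :=
  continuous_iff_continuousAt.2 fun t => (hasDerivAt_expSolution L f t).continuousAt

lemma contDiff_expSolution (L : X →L[ℝ] X) (f : X) : ContDiff ℝ 1 (expSolution L f) := by
  rw [contDiff_one_iff_deriv]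
  refine ⟨fun t => (hasDerivAt_expSolution L f t).differentiableAt, ?_⟩
  have : deriv (expSolution L f) = fun t => L (expSolution L f t) :=
    funext fun t => (hasDerivAt_expSolution L f t).deriv
  rw [this]
  exact L.continuous.comp (continuous_expSolution L f)

/-- A bounded `L` is Lipschitz, so ODE uniqueness applies once the equation holds at `0` too; there
the one-sided derivative is the limit of `L (h t)`. -/
lemma eqOn_expSolution (L : X →L[ℝ] X) {h : ℝ → X} (hc : ContinuousOn h (Ici 0))
    (hd : ∀ t, 0 < t → HasDerivAt h (L (h t)) t) : EqOn h (expSolution L (h 0)) (Ici 0) := by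
  intro T hT
  have hd0 : HasDerivWithinAt h (L (h 0)) (Ici 0) 0 := by
    refine hasDerivWithinAt_Ici_of_tendsto_deriv (s := Ioi 0)
      (fun t ht => (hd t ht).differentiableAt.differentiableWithinAt)
      ((hc 0 self_mem_Ici).mono Ioi_subset_Ici_self) self_mem_nhdsWithin ?_
    refine Tendsto.congr' (f₁ := fun t => L (h t)) ?_ ?_
    · filter_upwards [self_mem_nhdsWithin] with t ht using (hd t ht).deriv.symm
    · exact (L.continuous.tendsto _).comp
        ((hc 0 self_mem_Ici).mono Ioi_subset_Ici_self)
  refine ODE_solution_unique (v := fun _ => L) (K := ‖L‖₊) (a := 0) (b := T)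
    (fun _ => L.lipschitz) (hc.mono Icc_subset_Ici_self) (fun t ht => ?_)
    (continuous_expSolution L _).continuousOn
    (fun t _ => (hasDerivAt_expSolution L _ t).hasDerivWithinAt) (expSolution_zero L _).symm
    ⟨hT, le_rfl⟩
  rcases ht.1.eq_or_lt with rfl | h
  exacts [hd0, (hd t h).hasDerivWithinAt]

end semigroup

variable {S E : Type*} [TopologicalSpace S] [CompactSpace S] [MeasurableSpace S]
  [BorelSpace S] [MeasurableSpace E] {r : ℝ} {ν : Measure E} [IsProbabilityMeasure ν]
  {F : S → E → S}

lemma integral_path_renewal (hr : 0 < r) (hF : Measurable (Function.uncurry F))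
    (f : C(S, ℝ)) (x : S) {t : ℝ} :
    IntegrableOn (fun z => ∫ ω, f (path F (F x z.2) ω (t - z.1)) ∂noiseLaw r ν)
      (Prod.fst ⁻¹' Iic t) (stepLaw r ν) ∧
    ∫ ω, f (path F x ω t) ∂noiseLaw r ν =
      ∫ z in Prod.fst ⁻¹' Iic t, ∫ ω, f (path F (F x z.2) ω (t - z.1)) ∂noiseLaw r ν ∂stepLaw r ν +
      (expMeasure r).real (Ioi t) * f x := by
  have := isProbabilityMeasure_expMeasure hr
  have := isProbabilityMeasure_stepLaw (ν := ν) hr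
  have := isProbabilityMeasure_noiseLaw (ν := ν) hr
  have hFx : Measurable (F x) := hF.comp (measurable_const.prodMk measurable_id)
  have hint : Integrable (fun ω => f (path F x ω t)) (noiseLaw r ν) :=
    .of_bound (f.continuous.measurable.comp
      (measurable_path_apply hF x t)).aestronglyMeasurable ‖f‖
      (.of_forall fun _ => f.norm_coe_le_norm _)
  have hm : Measurable fun z : ℝ × E => ∫ ω, f (path F (F x z.2) ω (t - z.1)) ∂noiseLaw r ν := by
    have : StronglyMeasurable fun q : (ℝ × E) × (ℕ → ℝ × E) =>
        f (path F (F x q.1.2) q.2 (t - q.1.1)) :=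
      (f.continuous.measurable.comp ((measurable_path hF).comp (by fun_prop :
        Measurable fun q : (ℝ × E) × (ℕ → ℝ × E) => (t - q.1.1, F x q.1.2, q.2)))).stronglyMeasurable
    exact this.integral_prod_right.measurable
  have hbound : ∀ y s, ‖∫ ω, f (path F y ω s) ∂noiseLaw r ν‖ ≤ ‖f‖ := fun y s => by
    simpa using norm_integral_le_of_norm_le_const (μ := noiseLaw r ν)
      (.of_forall fun ω => f.norm_coe_le_norm (path F y ω s))
  have hint' : Integrable (fun z => ∫ ω, f (path F (F x z.2) ω (t - z.1)) ∂noiseLaw r ν)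
      (stepLaw r ν) :=
    .of_bound hm.aestronglyMeasurable ‖f‖ (.of_forall fun _ => hbound _ _)
  refine ⟨hint'.integrableOn, ?_⟩
  have hsplit : ∀ᵐ z ∂stepLaw r ν, ∫ ω, f (path F x (cons z ω) t) ∂noiseLaw r ν =
      (Prod.fst ⁻¹' Iic t).indicator
        (fun z => ∫ ω, f (path F (F x z.2) ω (t - z.1)) ∂noiseLaw r ν) z +
      (Prod.fst ⁻¹' Ioi t).indicator (fun _ => f x) z := by
    filter_upwards [ae_stepLaw_pos hr] with z hz
    rcases le_or_gt z.1 t with h | h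
    · rw [indicator_of_mem (show z ∈ Prod.fst ⁻¹' Iic t from h),
        indicator_of_notMem (by simpa using h), add_zero]
      refine integral_congr_ae ?_
      filter_upwards [ae_nonExplosive hr] with ω hω
      rw [path_cons F x hz.le hω, if_neg h.not_gt]
    · rw [indicator_of_notMem (by simpa using h), indicator_of_mem (by simpa using h), zero_add]
      have : ∀ ω, path F x (cons z ω) t = x := fun ω => path_of_lt F x h
      simp [this]
  have hmI : MeasurableSet (Prod.fst ⁻¹' Ioi t : Set (ℝ × E)) := measurable_fst measurableSet_Ioi
  rw [integral_noiseLaw hr _ hint, integral_congr_ae hsplit,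
    integral_add (hint'.indicator (measurable_fst measurableSet_Iic))
      ((integrable_const _).indicator hmI),
    integral_indicator (measurable_fst measurableSet_Iic), integral_indicator hmI,
    setIntegral_const, measureReal_def, stepLaw_fst_preimage]
  rfl

variable [T2Space S]

/-- Variation of constants: `L` is a jump term `r ∫ f(F x e) dν` minus `r f x`. Treating the first
as a source for the decay `exp(-rt)` gives the renewal equation of the process. -/
lemma expSolution_renewal (hr : 0 < r) (hF : Measurable (Function.uncurry F))
    (L : C(S, ℝ) →L[ℝ] C(S, ℝ)) (hL : ∀ f x, L f x = r * (∫ e, f (F x e) ∂ν - f x))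
    (f : C(S, ℝ)) (x : S) {t : ℝ} (ht : 0 ≤ t) :
    IntegrableOn (fun z => expSolution L f (t - z.1) (F x z.2)) (Prod.fst ⁻¹' Iic t)
      (stepLaw r ν) ∧
    expSolution L f t x =
      ∫ z in Prod.fst ⁻¹' Iic t, expSolution L f (t - z.1) (F x z.2) ∂stepLaw r ν +
      (expMeasure r).real (Ioi t) * f x := by
  have := isProbabilityMeasure_expMeasure hr
  have := isProbabilityMeasure_stepLaw (ν := ν) hr
  have hFx : Measurable (F x) := hF.comp (measurable_const.prodMk measurable_id)
  have hcont : Continuous fun q : ℝ × S => expSolution L f q.1 q.2 :=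
    ((continuous_expSolution L f).comp continuous_fst).eval continuous_snd
  have hm : Measurable fun z : ℝ × E => expSolution L f (t - z.1) (F x z.2) :=
    hcont.measurable.comp (by fun_prop : Measurable fun z : ℝ × E => (t - z.1, F x z.2))
  obtain ⟨C, hC⟩ := (isCompact_Icc (a := 0) (b := t)).exists_bound_of_continuousOn
    (continuous_expSolution L f).continuousOn
  have hint : IntegrableOn (fun z => expSolution L f (t - z.1) (F x z.2)) (Prod.fst ⁻¹' Iic t)
      (stepLaw r ν) := by
    refine Integrable.of_bound hm.aestronglyMeasurable C ?_
    filter_upwards [ae_restrict_mem (measurable_fst measurableSet_Iic),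
      ae_restrict_of_ae (ae_stepLaw_pos hr)] with z hz hz'
    have hz : z.1 ≤ t := hz
    exact (ContinuousMap.norm_coe_le_norm _ _).trans (hC _ ⟨by linarith, by linarith⟩)
  refine ⟨hint, ?_⟩
  have hQ : ∀ g : C(S, ℝ), r * ∫ e, g (F x e) ∂ν = L g x + r * g x := fun g => by
    rw [hL]; ring
  -- An explicit antiderivative in `τ` of the integrand; its boundary values on `[0, t]` are the two
  -- remaining terms of the renewal equation.
  have hderiv : ∀ τ, HasDerivAt (fun τ => -(Real.exp (-(r * τ)) * expSolution L f (t - τ) x))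
      (r * Real.exp (-(r * τ)) * ∫ e, expSolution L f (t - τ) (F x e) ∂ν) τ := by
    intro τ
    have h1 : HasDerivAt (fun τ => expSolution L f (t - τ) x)
        (-(L (expSolution L f (t - τ)) x)) τ :=
      (((ContinuousMap.evalCLM ℝ x : C(S, ℝ) →L[ℝ] ℝ).hasFDerivAt.comp_hasDerivAt _
        (hasDerivAt_expSolution L f (t - τ))).scomp τ ((hasDerivAt_id τ).const_sub t)).congr_deriv
        (by simp)
    have h2 : HasDerivAt (fun τ => Real.exp (-(r * τ))) (-(r * Real.exp (-(r * τ)))) τ := by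
      simpa using (hasDerivAt_neg_exp_mul_exp (r := r) (x := τ)).fun_neg
    refine (h2.mul h1).neg.congr_deriv ?_
    rw [mul_right_comm, hQ]
    ring
  have hcQI : Continuous fun τ =>
      r * Real.exp (-(r * τ)) * ∫ e, expSolution L f (t - τ) (F x e) ∂ν := by
    have : (fun τ => r * Real.exp (-(r * τ)) * ∫ e, expSolution L f (t - τ) (F x e) ∂ν) =
        fun τ => Real.exp (-(r * τ)) * (L (expSolution L f (t - τ)) x +
          r * expSolution L f (t - τ) x) := by
      ext τ
      rw [mul_right_comm, hQ, mul_comm]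
    rw [this]
    have := continuous_expSolution L f
    have h1 : Continuous fun τ => L (expSolution L f (t - τ)) x :=
      (ContinuousMap.evalCLM ℝ x).continuous.comp (L.continuous.comp (by fun_prop))
    have h2 : Continuous fun τ => expSolution L f (t - τ) x :=
      (ContinuousMap.evalCLM ℝ x).continuous.comp (by fun_prop)
    fun_prop
  have hFTC := intervalIntegral.integral_eq_sub_of_hasDerivAt (fun τ _ => hderiv τ)
    (hcQI.intervalIntegrable 0 t)
  have hprod : ∫ z in Prod.fst ⁻¹' Iic t, expSolution L f (t - z.1) (F x z.2) ∂stepLaw r ν =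
      ∫ τ in Iic t, ∫ e, expSolution L f (t - τ) (F x e) ∂ν ∂expMeasure r := by
    rw [← prod_univ] at hint ⊢
    rw [stepLaw] at hint ⊢
    rw [setIntegral_prod _ hint]
    simp
  have hdens : ∀ g : ℝ → ℝ, ∫ τ in Iic t, g τ ∂expMeasure r =
      ∫ τ in (0)..t, r * Real.exp (-(r * τ)) * g τ := by
    intro g
    have : ∫ τ in Iic t, g τ ∂expMeasure r = ∫ τ in Iic t, (exponentialPDF r τ).toReal * g τ := by
      rw [expMeasure, gammaMeasure, restrict_withDensity measurableSet_Iic]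
      exact integral_withDensity_eq_integral_toReal_smul (f := exponentialPDF r)
        (measurable_exponentialPDFReal r).ennreal_ofReal (by simp [exponentialPDF]) g
    rw [this, intervalIntegral.integral_of_le ht, ← integral_Icc_eq_integral_Ioc,
      ← integral_indicator measurableSet_Iic, ← integral_indicator measurableSet_Icc]
    congr 1
    ext τ
    simp only [indicator_apply, mem_Iic, mem_Icc]
    by_cases h0 : 0 ≤ τ
    · simp only [h0, true_and, exponentialPDF_of_nonneg h0]
      rw [ENNReal.toReal_ofReal (by positivity)]
    · simp [h0, exponentialPDF_of_neg (not_le.1 h0)]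
  have hIoi : (expMeasure r).real (Ioi t) = Real.exp (-(r * t)) := by
    rw [← compl_Iic, probReal_compl_eq_one_sub measurableSet_Iic, measureReal_def,
      expMeasure_Iic hr, if_pos ht, ENNReal.toReal_ofReal]
    · ring
    · have : Real.exp (-(r * t)) ≤ 1 := Real.exp_le_one_iff.2 (by nlinarith)
      linarith
  rw [hprod, hdens, hFTC, hIoi]
  simp [expSolution_zero]

/-- The semigroup of the jump process is generated by `L`. -/
lemma expSolution_eq_integral (hr : 0 < r) (hF : Measurable (Function.uncurry F))
    (L : C(S, ℝ) →L[ℝ] C(S, ℝ)) (hL : ∀ f x, L f x = r * (∫ e, f (F x e) ∂ν - f x))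
    (f : C(S, ℝ)) (x : S) {t : ℝ} (ht : 0 ≤ t) :
    expSolution L f t x = ∫ ω, f (path F x ω t) ∂noiseLaw r ν := by
  have := isProbabilityMeasure_noiseLaw (ν := ν) hr
  obtain ⟨C, hC⟩ := (isCompact_Icc (a := 0) (b := t)).exists_bound_of_continuousOn
    (continuous_expSolution L f).continuousOn
  suffices h : ‖expSolution L f t x - ∫ ω, f (path F x ω t) ∂noiseLaw r ν‖ₑ ≤ 0 from
    sub_eq_zero.1 (by simpa using h)
  -- The terms without a jump cancel in the difference of the two renewal equations, so the
  -- contraction principle forces its norm to be `0`.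
  refine le_of_forall_le_add_mul (I := {i : S × ℝ // 0 ≤ i.2 ∧ i.2 ≤ t})
    (u := fun i => ‖expSolution L f i.1.2 i.1.1 - ∫ ω, f (path F i.1.1 ω i.1.2) ∂noiseLaw r ν‖ₑ)
    (v := fun _ => 0) (C := ENNReal.ofReal (C + ‖f‖)) ENNReal.ofReal_ne_top
    (expMeasure_Iic_lt_one hr t) ?_ ?_ ⟨(x, t), ht, le_rfl⟩
  · rintro ⟨⟨y, s⟩, hs⟩
    rw [zero_add, ← ofReal_norm]
    refine ENNReal.ofReal_le_ofReal ((norm_sub_le _ _).trans (add_le_add ?_ ?_))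
    · exact (ContinuousMap.norm_coe_le_norm _ _).trans (hC s hs)
    · simpa using norm_integral_le_of_norm_le_const (μ := noiseLaw r ν)
        (.of_forall fun ω => f.norm_coe_le_norm (path F y ω s))
  · rintro c hc ⟨⟨y, s⟩, hs, hst⟩
    obtain ⟨h1, h1'⟩ := expSolution_renewal hr hF L hL f y hs
    obtain ⟨h2, h2'⟩ := integral_path_renewal (ν := ν) hr hF f y (t := s)
    simp only [zero_add] at hc ⊢
    rw [h1', h2', add_sub_add_right_eq_sub, ← integral_sub h1 h2]
    refine (enorm_integral_le_lintegral_enorm _).trans ?_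
    calc _ ≤ ∫⁻ _ in Prod.fst ⁻¹' Iic s, c ∂stepLaw r ν := by
          refine lintegral_mono_ae ?_
          filter_upwards [ae_restrict_mem (measurable_fst measurableSet_Iic),
            ae_restrict_of_ae (ae_stepLaw_pos hr)] with z hz hz'
          have hz : z.1 ≤ s := hz
          exact hc ⟨(F y z.2, s - z.1), by simp only; linarith, by simp only; linarith⟩
      _ ≤ _ := by
          rw [setLIntegral_const, stepLaw_fst_preimage, mul_comm c]
          gcongr

end JumpChain

/-! ### The transition function and the Markov process -/

namespace JumpChain

variable {S E : Type*} [MeasurableSpace S] [MeasurableSpace E] {r : ℝ} {ν : Measure E}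
  [IsProbabilityMeasure ν] {F : S → E → S}

/-- The law of the jump process at time `t`. -/
noncomputable def transition (hr : 0 < r) (ν : Measure E) [IsProbabilityMeasure ν]
    (hF : Measurable (Function.uncurry F)) (t : ℝ≥0) : Kernel S S where
  toFun x := (noiseLaw r ν).map fun ω => path F x ω t
  measurable' := by
    have := isProbabilityMeasure_noiseLaw (ν := ν) hr
    refine Measure.measurable_of_measurable_coe _ fun B hB => ?_
    simp only [Measure.map_apply (measurable_path_apply hF _ _) hB]
    exact measurable_measure_prodMk_left (measurable_path_left hF t hB)

lemma transition_apply (hr : 0 < r) (hF : Measurable (Function.uncurry F)) (t : ℝ≥0) (x : S) :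
    transition hr ν hF t x = (noiseLaw r ν).map fun ω => path F x ω t := rfl

lemma transition_apply_eq_pathProb (hr : 0 < r) (hF : Measurable (Function.uncurry F)) (t : ℝ≥0)
    (x : S) {B : Set S} (hB : MeasurableSet B) :
    transition hr ν hF t x B = pathProb r ν F {w | w t ∈ B} x := by
  rw [transition_apply, Measure.map_apply (measurable_path_apply hF _ _) hB]
  rfl

lemma map_path_zero (hr : 0 < r) (x : S) :
    ((noiseLaw r ν).map fun ω => path F x ω 0) = Measure.dirac x := by
  have := isProbabilityMeasure_noiseLaw (ν := ν) hr
  have h : (fun ω => path F x ω 0) =ᵐ[noiseLaw r ν] fun _ => x := by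
    filter_upwards [ae_waiting_pos hr 0] with ω hω using path_of_lt F x hω
  rw [Measure.map_congr h, Measure.map_const, measure_univ, one_smul]

lemma measurableSet_eval {B : Set S} (hB : MeasurableSet B) (t : ℝ≥0) :
    MeasurableSet {w : ℝ≥0 → S | w t ∈ B} := measurable_pi_apply t hB

lemma isTransitionFunction_transition (hr : 0 < r) (hF : Measurable (Function.uncurry F)) :
    IsTransitionFunction (transition hr ν hF) := by
  have := isProbabilityMeasure_noiseLaw (ν := ν) hr
  refine ⟨fun t x => Measure.isProbabilityMeasure_map (measurable_path_apply hF _ _).aemeasurable,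
    fun B hB => ?_, map_path_zero hr, fun s t x B hB => ?_⟩
  · simp only [transition_apply, Measure.map_apply (measurable_path_apply hF _ _) hB]
    refine measurable_measure_prodMk_left
      (s := {q : (ℝ≥0 × S) × (ℕ → ℝ × E) | path F q.1.2 q.2 q.1.1 ∈ B}) ?_
    exact ((measurable_path hF).comp (by fun_prop :
      Measurable fun q : (ℝ≥0 × S) × (ℕ → ℝ × E) => ((q.1.1 : ℝ), q.1.2, q.2))) hB
  -- Chapman-Kolmogorov is the Markov property with no condition on the past.
  · have h := jointProb_eq_restartProb (ν := ν) hr hF (measurableSet_eval hB t)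
      MeasurableSet.univ x s.coe_nonneg
    simp only [jointProb, restartProb, pastEvent, mem_univ, ofPred_true, univ_inter,
      Measure.restrict_univ] at h
    simp only [transition_apply_eq_pathProb hr hF t _ hB, transition_apply_eq_pathProb hr hF _ _ hB]
    rw [transition_apply, lintegral_map (measurable_pathProb hr hF (measurableSet_eval hB t))
      (measurable_path_apply hF _ _)]
    refine Eq.trans ?_ h
    simp [pathProb, futureEvent]

lemma iSup_comap_eq_comap_pi {Ω ι : Type*} (X : ι → Ω → S) :
    ⨆ i, MeasurableSpace.comap (X i) inferInstance =
      MeasurableSpace.comap (fun ω i => X i ω) MeasurableSpace.pi := by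
  simp only [MeasurableSpace.pi, MeasurableSpace.comap_iSup, MeasurableSpace.comap_comp]
  rfl

/-- The sample space carries the starting point as well as the noise, so that a single family of
maps serves all `P x = δ_x ⊗ noiseLaw`. -/
lemma isMarkovProcess_path (hr : 0 < r) (hF : Measurable (Function.uncurry F)) :
    IsMarkovProcess (transition hr ν hF) (Kernel.id ×ₖ Kernel.const S (noiseLaw r ν))
      (fun t q => path F q.1 q.2 t) := by
  have := isProbabilityMeasure_noiseLaw (ν := ν) hr
  have hP : ∀ x, (Kernel.id ×ₖ Kernel.const S (noiseLaw r ν)) x =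
      (noiseLaw r ν).map (Prod.mk x) := fun x => by
    rw [Kernel.prod_apply, Kernel.id_apply, Kernel.const_apply, Measure.dirac_prod]
  have hmk : ∀ x : S, Measurable (Prod.mk x : (ℕ → ℝ × E) → _) := fun x => measurable_prodMk_left
  refine ⟨fun x => inferInstance, fun t => measurable_path_left hF t, fun x => ?_,
    fun x s t B hB => ?_⟩
  · rw [hP, Measure.map_map (measurable_path_left hF _) (hmk x)]
    exact map_path_zero hr x
  set P := (Kernel.id ×ₖ Kernel.const S (noiseLaw r ν)) x with hPdef
  have hle : (⨆ r : Iic s, MeasurableSpace.comap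
      (fun q : S × (ℕ → ℝ × E) => path F q.1 q.2 (r : ℝ≥0)) inferInstance) ≤
      (inferInstance : MeasurableSpace (S × (ℕ → ℝ × E))) :=
    iSup_le fun r => (measurable_path_left hF (r : ℝ≥0)).comap_le
  have hB' : MeasurableSet ((fun q : S × (ℕ → ℝ × E) => path F q.1 q.2 (s + t : ℝ≥0)) ⁻¹' B) :=
    measurable_path_left hF _ hB
  have hp : Measurable fun y => transition hr ν hF t y B := Kernel.measurable_coe _ hB
  have hprob : ∀ y, IsProbabilityMeasure (transition hr ν hF t y) :=
    (isTransitionFunction_transition hr hF).isProbabilityMeasure t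
  have hps : Measurable fun q : S × (ℕ → ℝ × E) => transition hr ν hF t (path F q.1 q.2 s) B :=
    hp.comp (measurable_path_left hF _)
  have hgint : Integrable (fun q : S × (ℕ → ℝ × E) =>
      (transition hr ν hF t (path F q.1 q.2 s)).real B) P :=
    .of_bound hps.ennreal_toReal.aestronglyMeasurable 1 (.of_forall fun q => by
      rw [Real.norm_of_nonneg measureReal_nonneg]
      exact measureReal_le_one)
  refine (ae_eq_condExp_of_forall_setIntegral_eq hle ((integrable_const _).indicator hB')
    (fun _ _ _ => hgint.integrableOn) (fun A hA _ => ?_) ?_).symm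
  · have hAm := hle A hA
    have hA' : MeasurableSet[MeasurableSpace.comap (fun (q : S × (ℕ → ℝ × E)) (r : Iic s) =>
        path F q.1 q.2 (r : ℝ≥0)) MeasurableSpace.pi] A := by
      rwa [← iSup_comap_eq_comap_pi]
    obtain ⟨A', hA', rfl⟩ := hA'
    -- An event of the past is a set of paths restricted to times up to `s`, where the path and the
    -- path stopped at `s` coincide.
    have hG : MeasurableSet {w : ℝ → S | (fun r : Iic s => w (r : ℝ≥0)) ∈ A'} :=
      (measurable_pi_lambda _ fun r : Iic s => measurable_pi_apply ((r : ℝ≥0) : ℝ)) hA'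
    have h := jointProb_eq_restartProb (ν := ν) hr hF (measurableSet_eval hB t) hG x s.coe_nonneg
    have hpast : pastEvent F {w : ℝ → S | (fun r : Iic s => w (r : ℝ≥0)) ∈ A'} x (s : ℝ) =
        Prod.mk x ⁻¹' ((fun (q : S × (ℕ → ℝ × E)) (r : Iic s) => path F q.1 q.2 (r : ℝ≥0)) ⁻¹'
          A') := by
      ext ω
      have : ∀ r : Iic s, min ((r : ℝ≥0) : ℝ) s = (r : ℝ≥0) := fun r => min_eq_left r.2
      simp only [pastEvent, mem_ofPred_eq, mem_preimage, this]
    rw [jointProb, restartProb, hpast] at h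
    rw [integral_indicator hB', setIntegral_const, smul_eq_mul, mul_one,
      measureReal_restrict_apply hB', measureReal_def]
    simp only [measureReal_def]
    rw [integral_toReal hps.aemeasurable (.of_forall fun _ => measure_lt_top _ _), hPdef, hP,
      Measure.map_apply (hmk x) (hB'.inter hAm), inter_comm, preimage_inter,
      ← lintegral_indicator hAm, lintegral_map (hps.indicator hAm) (hmk x)]
    simp only [transition_apply_eq_pathProb hr hF t _ hB]
    congr 1
    refine Eq.trans ?_ (h.symm.trans ?_)
    · rw [← lintegral_indicator (hmk x hAm)]
      rfl
    · congr 2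
  · refine Measurable.aestronglyMeasurable ?_
    refine (hp.comp ?_).ennreal_toReal
    refine Measurable.mono (comap_measurable _) ?_ le_rfl
    exact le_iSup (fun r : Iic s => MeasurableSpace.comap
      (fun q : S × (ℕ → ℝ × E) => path F q.1 q.2 (r : ℝ≥0)) inferInstance) ⟨s, self_mem_Iic⟩

end JumpChain

/-! ### Processes with a continuous jump kernel on a compact space -/

lemma isCauchySolution_expSolution {S : Type*} [TopologicalSpace S] [CompactSpace S]
    {L₀ : (S → ℝ) → S → ℝ} (L : C(S, ℝ) →L[ℝ] C(S, ℝ)) (hL : ∀ f x, L f x = L₀ f x)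
    (h₀ : C(S, ℝ)) :
    IsCauchySolution L₀ h₀ (JumpChain.expSolution L h₀) ∧
      SatisfiesEvolutionEqAt L₀ (JumpChain.expSolution L h₀) 0 ∧
      ∀ h', IsCauchySolution L₀ h₀ h' → EqOn h' (JumpChain.expSolution L h₀) (Ici 0) := by
  have heq : ∀ t, SatisfiesEvolutionEqAt L₀ (JumpChain.expSolution L h₀) t := fun t =>
    ⟨_, (JumpChain.hasDerivAt_expSolution L h₀ t).hasDerivWithinAt, hL _⟩
  refine ⟨⟨(JumpChain.continuous_expSolution L h₀).continuousOn,
    (JumpChain.contDiff_expSolution L h₀).contDiffOn, fun t _ => heq t,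
    JumpChain.expSolution_zero L h₀⟩, heq 0, fun h' hh' => ?_⟩
  have h := JumpChain.eqOn_expSolution L hh'.continuousOn fun t ht => ?_
  · rwa [hh'.init] at h
  · obtain ⟨g, hg, hg'⟩ := hh'.eqn t ht
    rw [ContinuousMap.ext (g := g) fun x => (hL (h' t) x).trans (hg' x).symm]
    exact hg.hasDerivAt (Ici_mem_nhds ht)

/-- The bounded generator of the jump process with continuous jump kernel `k`. -/
lemma exists_continuousLinearMap_eq_integral_kernel {S : Type*} [TopologicalSpace S]
    [CompactSpace S] [T2Space S] [SecondCountableTopology S] [MeasurableSpace S] [BorelSpace S]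
    (m : Measure S) [IsFiniteMeasure m] {k : S → S → ℝ} (hk : Continuous (Function.uncurry k))
    {M : ℝ} (hM : ∀ x y, |k x y| ≤ M) :
    ∃ L : C(S, ℝ) →L[ℝ] C(S, ℝ), ∀ f x, L f x = ∫ y, k x y * (f y - f x) ∂m := by
  have hcont : ∀ f : C(S, ℝ), Continuous fun q : S × S => k q.1 q.2 * (f q.2 - f q.1) :=
    fun f => hk.mul (by fun_prop)
  have hint : ∀ (f : C(S, ℝ)) x, Integrable (fun y => k x y * (f y - f x)) m := fun f x => by
    have : Continuous fun y => k x y * (f y - f x) :=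
      (hcont f).comp (continuous_const.prodMk continuous_id)
    exact this.integrable_of_hasCompactSupport (HasCompactSupport.of_compactSpace _)
  let T : C(S, ℝ) →ₗ[ℝ] C(S, ℝ) :=
    { toFun := fun f => ⟨fun x => ∫ y, k x y * (f y - f x) ∂m, by
        simpa using continuous_parametric_integral_of_continuous (μ := m)
          (f := fun x y => k x y * (f y - f x)) (hcont f) isCompact_univ⟩
      map_add' := fun f g => by
        ext x
        simp only [ContinuousMap.coe_mk, ContinuousMap.add_apply]
        rw [← integral_add (hint f x) (hint g x)]
        exact integral_congr_ae (.of_forall fun y => by ring)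
      map_smul' := fun c f => by
        ext x
        simp only [ContinuousMap.coe_mk, ContinuousMap.smul_apply, RingHom.id_apply, smul_eq_mul]
        rw [← integral_const_mul]
        exact integral_congr_ae (.of_forall fun y => by ring) }
  refine ⟨T.mkContinuous (M * 2 * m.real univ) fun f => ?_, fun f x => rfl⟩
  rcases isEmpty_or_nonempty S with h | ⟨⟨z⟩⟩
  · have hf : f = 0 := by ext x; exact h.elim x
    simp [hf]
  have hM₀ : 0 ≤ M := (abs_nonneg _).trans (hM z z)
  refine (ContinuousMap.norm_le _ (by positivity)).2 fun x => ?_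
  calc ‖T f x‖ ≤ M * (2 * ‖f‖) * m.real univ := by
        refine norm_integral_le_of_norm_le_const (.of_forall fun y => ?_)
        rw [norm_mul]
        refine mul_le_mul (hM x y) ?_ (norm_nonneg _) hM₀
        calc ‖f y - f x‖ ≤ ‖f y‖ + ‖f x‖ := norm_sub_le _ _
          _ ≤ 2 * ‖f‖ := by linarith [f.norm_coe_le_norm x, f.norm_coe_le_norm y]
    _ = _ := by ring

open Classical in
/-- The random map that jumps from `x` to `y` if `u ≤ a x y` and otherwise stays at `x`. -/
noncomputable def thinning {S : Type*} (a : S → S → ℝ) (x : S) (e : S × ℝ) : S :=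
  if e.2 ≤ a x e.1 then e.1 else x

lemma measurable_thinning {S : Type*} [MeasurableSpace S] {a : S → S → ℝ}
    (ha : Measurable (Function.uncurry a)) : Measurable (Function.uncurry (thinning a)) := by
  classical
  refine Measurable.ite (measurableSet_le (by fun_prop) ?_) (by fun_prop) (by fun_prop)
  exact ha.comp (by fun_prop : Measurable fun q : S × S × ℝ => (q.1, q.2.1))

/-- A proposal `y` is accepted with probability `a x y`, the length of `[0, a x y]`, and a rejected
one contributes nothing. -/
lemma integral_thinning_sub {S : Type*} [MeasurableSpace S] {a : S → S → ℝ}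
    (ha : Measurable (Function.uncurry a)) (ha₀ : ∀ x y, 0 ≤ a x y) (ha₁ : ∀ x y, a x y ≤ 1)
    (m : Measure S) [IsProbabilityMeasure m] {f : S → ℝ} (hf : Measurable f) {C : ℝ}
    (hC : ∀ x, ‖f x‖ ≤ C) (x : S) :
    ∫ e, f (thinning a x e) ∂m.prod (volume.restrict (Icc (0 : ℝ) 1)) - f x =
      ∫ y, a x y * (f y - f x) ∂m := by
  classical
  have : IsProbabilityMeasure (volume.restrict (Icc (0 : ℝ) 1)) := ⟨by simp⟩
  have hm : Measurable (thinning a x) :=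
    (measurable_thinning ha).comp (measurable_const.prodMk measurable_id)
  have hint : Integrable (fun e => f (thinning a x e)) (m.prod (volume.restrict (Icc (0 : ℝ) 1))) :=
    .of_bound (hf.comp hm).aestronglyMeasurable C (.of_forall fun _ => hC _)
  have hsub : ∫ e, f (thinning a x e) ∂m.prod (volume.restrict (Icc (0 : ℝ) 1)) - f x =
      ∫ e, (f (thinning a x e) - f x) ∂m.prod (volume.restrict (Icc (0 : ℝ) 1)) := by
    rw [integral_sub hint (integrable_const _)]
    simp
  rw [hsub]
  refine (integral_prod _ (hint.sub (integrable_const _))).trans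
    (integral_congr_ae (.of_forall fun y => ?_))
  have : ∀ u, f (thinning a x (y, u)) - f x = (Iic (a x y)).indicator (fun _ => f y - f x) u := by
    intro u
    simp only [thinning, indicator_apply, mem_Iic]
    split_ifs <;> simp
  have hvol : Iic (a x y) ∩ Icc 0 1 = Icc 0 (a x y) := by
    ext u
    simp only [mem_inter_iff, mem_Iic, mem_Icc]
    exact ⟨fun h => ⟨h.2.1, h.1⟩, fun h => ⟨h.2, h.1, h.2.trans (ha₁ x y)⟩⟩
  simp only [Pi.sub_apply, this]
  rw [integral_indicator measurableSet_Iic, Measure.restrict_restrict measurableSet_Iic, hvol,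
    setIntegral_const, Real.volume_real_Icc_of_le (ha₀ x y), sub_zero, smul_eq_mul]

theorem exists_jumpProcess {S : Type u} [TopologicalSpace S] [CompactSpace S] [T2Space S]
    [SecondCountableTopology S] [MeasurableSpace S] [BorelSpace S] [Nonempty S] (m : Measure S)
    [IsFiniteMeasure m] [NeZero m] {k : S → S → ℝ} (hk : Continuous (Function.uncurry k))
    (hk₀ : ∀ x y, 0 ≤ k x y) {ε : ℝ} (hε : 0 < ε) :
    ∃ p : ℝ≥0 → Kernel S S, IsTransitionFunction p ∧
      (∀ h₀ : C(S, ℝ), ∃ h : ℝ → C(S, ℝ),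
        IsCauchySolution (fun f x => ε * ∫ y, k x y * (f y - f x) ∂m) h₀ h ∧
        SatisfiesEvolutionEqAt (fun f x => ε * ∫ y, k x y * (f y - f x) ∂m) h 0 ∧
        (∀ h' : ℝ → C(S, ℝ),
          IsCauchySolution (fun f x => ε * ∫ y, k x y * (f y - f x) ∂m) h₀ h' →
            EqOn h' h (Ici 0)) ∧
        ∀ (t : ℝ≥0) (x : S), h t x = ∫ y, h₀ y ∂(p t x)) ∧
      ∃ (Ω : Type u) (_ : MeasurableSpace Ω) (P : Kernel S Ω) (X : ℝ≥0 → Ω → S),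
        IsMarkovProcess p P X ∧ ∀ ω, IsCadlagPath fun t => X t ω := by
  obtain ⟨M, hM⟩ : ∃ M, ∀ x y, |k x y| ≤ M := by
    obtain ⟨M, hM⟩ := isCompact_univ.exists_bound_of_continuousOn hk.continuousOn
    exact ⟨M, fun x y => hM (x, y) (mem_univ _)⟩
  have hM' : ∀ x y, |k x y| ≤ |M| + 1 := fun x y =>
    (hM x y).trans ((le_abs_self M).trans (by linarith))
  -- The added `1` keeps the divisor `N` positive even when the kernel vanishes.
  generalize hN : |M| + 1 = N at hM'
  have hN₀ : 0 < N := by rw [← hN]; positivity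
  obtain ⟨L, hL⟩ := exists_continuousLinearMap_eq_integral_kernel m hk hM'
  have hm : 0 < m.real univ := by
    rw [measureReal_def, ENNReal.toReal_pos_iff]
    exact ⟨pos_iff_ne_zero.2 (NeZero.ne _), measure_lt_top _ _⟩
  let a : S → S → ℝ := fun x y => k x y / N
  have ha : Measurable (Function.uncurry a) := (hk.div_const N).measurable
  have hF := measurable_thinning ha
  -- The rate compensates for the division of `k` by `N` and of `m` by its total mass.
  let r := ε * N * m.real univ
  have hr : 0 < r := by positivity
  have : IsProbabilityMeasure (volume.restrict (Icc (0 : ℝ) 1)) := ⟨by simp⟩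
  let ν := ((m univ)⁻¹ • m).prod (volume.restrict (Icc (0 : ℝ) 1))
  have hLν : ∀ (f : C(S, ℝ)) x, (ε • L) f x = r * (∫ e, f (thinning a x e) ∂ν - f x) := by
    intro f x
    rw [integral_thinning_sub ha (fun x y => div_nonneg (hk₀ x y) hN₀.le)
      (fun x y => (div_le_one hN₀).2 ((le_abs_self _).trans (hM' x y))) _ f.continuous.measurable
      f.norm_coe_le_norm, integral_smul_measure]
    have : ∀ y, a x y * (f y - f x) = N⁻¹ * (k x y * (f y - f x)) := fun y => by
      simp only [a]
      ring
    simp only [this, integral_const_mul, _root_.smul_apply,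
      ContinuousMap.smul_apply, hL, smul_eq_mul, r, ENNReal.toReal_inv, measureReal_def] at hm ⊢
    field_simp
  refine ⟨JumpChain.transition hr ν hF, JumpChain.isTransitionFunction_transition hr hF,
    fun h₀ => ⟨JumpChain.expSolution (ε • L) h₀, ?_⟩, S × (ℕ → ℝ × S × ℝ), inferInstance, _, _,
    JumpChain.isMarkovProcess_path hr hF, fun q => JumpChain.isCadlagPath_path _ _ _⟩
  obtain ⟨h1, h2, h3⟩ := isCauchySolution_expSolution
    (L₀ := fun f x => ε * ∫ y, k x y * (f y - f x) ∂m) (ε • L) (fun f x => by simp [hL]) h₀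
  refine ⟨h1, h2, h3, fun t x => ?_⟩
  rw [JumpChain.transition_apply, integral_map (JumpChain.measurable_path_apply hF x t).aemeasurable
    h₀.continuous.measurable.aestronglyMeasurable]
  exact JumpChain.expSolution_eq_integral hr hF _ hLν h₀ x t.coe_nonneg

/-! ### Verticial coverings and continuity of the kernel -/

section verticial

variable {K : Type u} [NormedField K] {ι : Type*} {Z : Set K} {U : ι → Set K}

/-- By the strong triangle inequality, moving a point by less than `r` does not change its distance
`r` to a centre. The equal radius gives one ball that works for all the spheres, even infinitely
many. -/
lemma IsVerticialCovering.isOpen [IsUltrametricDist K] (hU : IsVerticialCovering Z U) (i : ι) :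
    IsOpen (U i) := by
  obtain ⟨r, hr, C, -, hC⟩ := hU.spheres i
  rw [Metric.isOpen_iff]
  intro x hx
  refine ⟨r, hr, fun y hy => ?_⟩
  rw [hC] at hx ⊢
  refine mem_iInter₂.2 fun c hc => ?_
  have hxc : dist x c = r := mem_iInter₂.1 hx c hc
  have hyx : dist y x < r := hy
  rw [Metric.mem_sphere, IsUltrametricDist.dist_eq_max_of_dist_ne_dist y x c
    (by rw [hxc]; exact hyx.ne), hxc, max_eq_right hyx.le]

lemma IsVerticialCovering.isClopen_preimage [IsUltrametricDist K] (hU : IsVerticialCovering Z U)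
    (i : ι) : IsClopen (Subtype.val ⁻¹' U i : Set Z) := by
  refine ⟨⟨?_⟩, (hU.isOpen i).preimage continuous_subtype_val⟩
  have : (Subtype.val ⁻¹' U i : Set Z)ᶜ = Subtype.val ⁻¹' ⋃ j ∈ ({i}ᶜ : Set ι), U j := by
    ext ⟨x, hx⟩
    rw [← hU.iUnion_eq] at hx
    obtain ⟨j, hj⟩ := mem_iUnion.1 hx
    simp only [mem_compl_iff, mem_preimage, mem_iUnion, mem_singleton_iff, exists_prop]
    constructor
    · exact fun h => ⟨j, fun hji => h (hji ▸ hj), hj⟩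
    · rintro ⟨l, hl, hxl⟩ hxi
      exact Set.disjoint_left.1 (hU.disjoint l i hl) hxl hxi
  rw [this]
  exact (isOpen_biUnion fun j _ => hU.isOpen j).preimage continuous_subtype_val

/-- Only terms with `i ≠ j` survive. Each lives on the clopen set `U i × U j`, which misses the
diagonal, so the power is continuous there for every real `α` and extends continuously by zero. -/
lemma IsVerticialCovering.continuous_zunigaKernel [Fintype ι] [IsUltrametricDist K]
    (hU : IsVerticialCovering Z U) {A : Matrix ι ι ℝ} (hA : ∀ i, A i i = 0) (α : ℝ) :
    Continuous fun q : Z × Z => zunigaKernel U A α (q.1 : K) (q.2 : K) := by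
  unfold zunigaKernel
  refine continuous_finsetSum _ fun i _ => continuous_finsetSum _ fun j _ => ?_
  rcases eq_or_ne i j with rfl | hij
  · simp only [hA, zero_mul]
    exact continuous_const
  have hclopen : IsClopen ((Subtype.val ⁻¹' U i : Set Z) ×ˢ (Subtype.val ⁻¹' U j : Set Z)) :=
    (hU.isClopen_preimage i).prod (hU.isClopen_preimage j)
  have : (fun q : Z × Z => A i j * ‖(q.1 : K) - q.2‖ ^ α * (U i).indicator 1 (q.1 : K) *
      (U j).indicator 1 (q.2 : K)) =
      ((Subtype.val ⁻¹' U i : Set Z) ×ˢ (Subtype.val ⁻¹' U j : Set Z)).indicator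
        fun q => A i j * ‖(q.1 : K) - q.2‖ ^ α := by
    classical
    ext q
    simp only [indicator_apply, mem_prod, mem_preimage, Pi.one_apply]
    split_ifs <;> simp_all
  rw [this]
  refine continuous_indicator (by simp [hclopen.frontier_eq]) ?_
  rw [hclopen.1.closure_eq]
  refine continuousOn_const.mul (ContinuousOn.rpow_const (by fun_prop) ?_)
  rintro ⟨x, y⟩ ⟨hx, hy⟩
  refine Or.inl (norm_ne_zero_iff.2 (sub_ne_zero.2 fun hxy => ?_))
  exact Set.disjoint_left.1 (hU.disjoint i j hij) hx (hxy ▸ hy)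

lemma zunigaKernel_nonneg [Fintype ι] {A : Matrix ι ι ℝ} (hA : ∀ i j, 0 ≤ A i j) (α : ℝ)
    (x y : K) : 0 ≤ zunigaKernel U A α x y :=
  Finset.sum_nonneg fun i _ => Finset.sum_nonneg fun j _ =>
    mul_nonneg (mul_nonneg (mul_nonneg (hA i j) (Real.rpow_nonneg (norm_nonneg _) _))
      (indicator_nonneg (fun _ _ => zero_le_one) _)) (indicator_nonneg (fun _ _ => zero_le_one) _)

end verticial

/-! ### The empty space and the conclusion -/

theorem exists_process_of_isEmpty {S : Type u} [TopologicalSpace S] [CompactSpace S]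
    [MeasurableSpace S] [IsEmpty S] (L : (S → ℝ) → S → ℝ) :
    ∃ p : ℝ≥0 → Kernel S S, IsTransitionFunction p ∧
      (∀ h₀ : C(S, ℝ), ∃ h : ℝ → C(S, ℝ),
        IsCauchySolution L h₀ h ∧ SatisfiesEvolutionEqAt L h 0 ∧
        (∀ h' : ℝ → C(S, ℝ), IsCauchySolution L h₀ h' → EqOn h' h (Ici 0)) ∧
        ∀ (t : ℝ≥0) (x : S), h t x = ∫ y, h₀ y ∂(p t x)) ∧
      ∃ (Ω : Type u) (_ : MeasurableSpace Ω) (P : Kernel S Ω) (X : ℝ≥0 → Ω → S),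
        IsMarkovProcess p P X ∧ ∀ ω, IsCadlagPath fun t => X t ω := by
  have hsub : ∀ f g : C(S, ℝ), f = g := fun f g => ContinuousMap.ext isEmptyElim
  refine ⟨fun _ => 0, ⟨fun _ => isEmptyElim, fun _ _ => ?_, isEmptyElim, fun _ _ => isEmptyElim⟩,
    fun h₀ => ?_, S, inferInstance, 0, fun _ => id,
    ⟨isEmptyElim, fun _ => measurable_id, isEmptyElim, isEmptyElim⟩, isEmptyElim⟩
  · have : IsEmpty (ℝ≥0 × S) := ⟨fun q => isEmptyElim q.2⟩
    exact measurable_of_empty _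
  · obtain ⟨h1, h2, h3⟩ := isCauchySolution_expSolution (L₀ := L) 0 (fun _ => isEmptyElim) h₀
    exact ⟨_, h1, h2, h3, fun _ => isEmptyElim⟩

theorem mainTheorem4 {K : Type u} [NontriviallyNormedField K] [IsUltrametricDist K]
    [LocallyCompactSpace K] [MeasurableSpace K] [BorelSpace K]
    (μ : Measure K) [μ.IsAddHaarMeasure] (hμ : μ (Metric.closedBall 0 1) = 1)
    (Z : Set K) [CompactSpace Z] (hZ : IsOpen Z)
    {ι : Type*} [Fintype ι] (U : ι → Set K) (hU : IsVerticialCovering Z U)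
    (A : Matrix ι ι ℝ) (hAsymm : A.IsSymm) (hAnonneg : ∀ i j, 0 ≤ A i j)
    (hAdiag : ∀ i, A i i = 0) (α : ℝ) (ε : ℝ) (hε : 0 < ε) :
    ∃ p : ℝ≥0 → Kernel Z Z, IsTransitionFunction p ∧
      (∀ h₀ : C(Z, ℝ), ∃ h : ℝ → C(Z, ℝ),
        IsCauchySolution (fun f x => ε * zunigaOperator μ Z U A α f x) h₀ h ∧
        SatisfiesEvolutionEqAt (fun f x => ε * zunigaOperator μ Z U A α f x) h 0 ∧
        (∀ h' : ℝ → C(Z, ℝ),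
          IsCauchySolution (fun f x => ε * zunigaOperator μ Z U A α f x) h₀ h' →
            EqOn h' h (Ici 0)) ∧
        ∀ (t : ℝ≥0) (x : Z), h t x = ∫ y, h₀ y ∂(p t x)) ∧
      ∃ (Ω : Type u) (_ : MeasurableSpace Ω) (P : Kernel Z Ω) (X : ℝ≥0 → Ω → Z),
        IsMarkovProcess p P X ∧ ∀ ω, IsCadlagPath fun t => X t ω := by
  rcases isEmpty_or_nonempty Z with hempty | hne
  -- The empty set has measure zero, so no law for the proposals could be normalized.
  · exact exists_process_of_isEmpty _
  -- Properness makes `K`, hence `Z`, second countable, so that the continuous kernel on `Z × Z` is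
  -- measurable for the product σ-algebra.
  have : ProperSpace K := .of_locallyCompactSpace K
  have hmeas : (μ.comap Subtype.val : Measure Z) univ = μ Z := by
    rw [comap_subtype_coe_apply hZ.measurableSet]
    simp
  have hcomp : IsCompact Z := isCompact_iff_compactSpace.2 inferInstance
  have : IsFiniteMeasure (μ.comap Subtype.val : Measure Z) := ⟨by
    rw [hmeas]
    exact hcomp.measure_lt_top⟩
  have : NeZero (μ.comap Subtype.val : Measure Z) := ⟨fun h => by
    rw [h] at hmeas
    exact hZ.measure_ne_zero μ (nonempty_coe_sort.1 hne) (by simpa using hmeas.symm)⟩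
  exact exists_jumpProcess (μ.comap Subtype.val)
    (hU.continuous_zunigaKernel hAdiag α) (fun x y => zunigaKernel_nonneg hAnonneg α _ _) hε
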